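/- Let $\Omega=(0,2\pi)^2$. Let $H$ be the closed subspace of $L^2(\Omega;\mathbb R^2)$ of $2\pi$-periodic, mean-free, (distributionally) divergence-free vector fields, with norm $|u|=\left(\int_\Omega|u|^2dx\right)^{1/2}$; let $\mathbb P$ be the orthogonal projection onto $H$, $V=\{u\in H:\partial_ju\in L^2,\ j=1,2\}$ with norm $\|u\|=\big(\sum_j|\partial_ju|^2\big)^{1/2}$, $A=-\mathbb P\Delta$ with domain $D(A)=\{u\in V:\partial_i\partial_ju\in L^2,\ i,j=1,2\}$, $B(u,v)=\mathbb P((u\cdot\nabla)v)$, and, for real $N>0$, let $P_N$ be the projection onto the Fourier modes $k\in\mathbb Z^2$ with $|k|\le N$. Let $\nu>0$. For initial data in $V$, a (global) strong solution $u$ of an equation $\frac{du}{dt}+\nu Au+B(u,u)=F$ is one with $u\in C([0,T];V)\cap L^2(0,T;D(A))$ and $\frac{du}{dt}\in L^2(0,T;H)$ for all $T>0$, the equation holding in $H$ for a.e. $t>0$. For $f\in L^\infty(0,\infty;H)$ the Olson–Titi synchronization filter with cut-off $N$ is the system $$\frac{dv}{dt}+\nu Av+B(v,v)=f+P_NB(v,v)-P_NB(u,u),\quad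 v(0)=v_0,\qquad \frac{du}{dt}+\nu Au+B(u,u)=f,\quad u(0)=u_0.$$ It has the synchronization property (for $f$) if for all $u_0,v_0\in V$ there is $N^*=N^*(u_0,v_0,f)>0$ such that, for every $N\ge N^*$, its strong solutions satisfy $|v(t)-u(t)|\to0$ as $t\to\infty$. An intertwinement of the Navier–Stokes equations, given by a matrix $M=(m_{ij})\in\mathbb R^{2\times2}$ and functions $F_1,F_2:V\to H$ with $F_1(0)=F_2(0)=0$, is the system $$\frac{dv_i}{dt}+\nu Av_i+B(v_i,v_i)=g_i+m_{i1}F_1(v_1)+m_{i2}F_2(v_2),\quad v_i(0)=v_0^i,\qquad i=1,2.$$ It is finite-dimensionally assisted self-synchronous for $g_1,g_2\in L^\infty(0,\infty;H)$ if there is $N>0$ such that for all $v_0^1,v_0^2\in V$ and corresponding strong solutions: if $|P_Nv_1(t)-P_Nv_2(t)|\to0$ and $|g_1(t)-g_2(t)|\to0$ as $t\to\infty$, then $|v_1(t)-v_2(t)|\to0$ as $t\to\infty$. The trivial intertwinement is the one with $F_1=F_2\equiv0$. **Theorem.** Let $\nu>0$ and $f_1,f_2\in L^\infty(0,\infty;H)$,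 and suppose that the synchronization filter has the synchronization property for $f_1$ and for $f_2$. Then the 2D Navier–Stokes equations have the finite determining modes property for $f_1,f_2$: there exists $N>0$ such that for all $u_0^1,u_0^2\in V$, the strong solutions $u_j$ of $\frac{du_j}{dt}+\nu Au_j+B(u_j,u_j)=f_j$, $u_j(0)=u_0^j$ ($j=1,2$), satisfy $$|P_Nu_1(t)-P_Nu_2(t)|\to0\ \text{ and }\ |f_1(t)-f_2(t)|\to0\ \text{ as }t\to\infty\quad\Longrightarrow\quad|u_1(t)-u_2(t)|\to0\ \text{ as }t\to\infty.$$ Equivalently, under the same hypothesis, the trivial intertwinement (with any $M$) is finite-dimensionally assisted self-synchronous for $g_1=f_1$, $g_2=f_2$. (The limits of $|f_1-f_2|$ and $|g_1-g_2|$ are taken up to null sets of times.) -/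

import Mathlib

open MeasureTheory Set Filter Topology
open scoped ContDiff

noncomputable section

namespace NavierStokes2D

/-- The plane `ℝ²` of points `x`. -/
abbrev Plane : Type := Fin 2 → ℝ

/-- The target `ℝ²` of vector fields, with the Euclidean norm. -/
abbrev Vec : Type := EuclideanSpace ℝ (Fin 2)

/-- The open period cell `Ω = (0, 2π)²`. -/
def cell : Set Plane := Set.pi Set.univ fun _ => Ioo (0 : ℝ) (2 * Real.pi)

/-- Lebesgue measure on the period cell. -/
def cellMeasure : Measure Plane := volume.restrict cell

/-- Square integrable vector fields on the period cell; its norm is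
`|u| = (∫_Ω |u(x)|² dx)^(1/2)`. A `2π`-periodic field is identified with its restriction to the
cell. -/
abbrev L2 : Type := Lp Vec 2 cellMeasure

/-- Smooth real functions on the plane that are `2π`-periodic in each direction. -/
structure IsPeriodicTest (φ : Plane → ℝ) : Prop where
  smooth : ContDiff ℝ ∞ φ
  periodic : ∀ (x : Plane) (k : Fin 2 → ℤ), φ (fun j => x j + 2 * Real.pi * (k j : ℝ)) = φ x

/-- The classical partial derivative `∂_j φ(x)`. -/
def classicalPartial (j : Fin 2) (φ : Plane → ℝ) (x : Plane) : ℝ :=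
  fderiv ℝ φ x (Pi.single j 1)

/-- The classical gradient `∇φ(x)`. -/
def classicalGrad (φ : Plane → ℝ) (x : Plane) : Vec :=
  WithLp.toLp 2 fun j => classicalPartial j φ x

/-- The constant fields and the gradients of smooth periodic functions. -/
def constantsAndGradients : Set L2 :=
  {w | (∃ a : Vec, ∀ᵐ x ∂cellMeasure, w x = a) ∨
    ∃ φ : Plane → ℝ, IsPeriodicTest φ ∧ ∀ᵐ x ∂cellMeasure, w x = classicalGrad φ x}

/-- The space `H` of periodic `L²` fields which are mean-free (`∫_Ω u · a = 0` for every constant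
`a`) and divergence-free in the sense of distributions (`∫_Ω u · ∇φ = 0` for every smooth periodic
`φ`); it is a closed subspace of `L²`. -/
def H : Submodule ℝ L2 := (Submodule.span ℝ constantsAndGradients)ᗮ

instance : CompleteSpace H := inferInstanceAs (CompleteSpace (Submodule.span ℝ _)ᗮ)

/-- The Leray projection: the orthogonal projection of `L²` onto `H`. -/
def leray : L2 →L[ℝ] L2 := H.starProjection

/-- `g` is the weak partial derivative `∂_j u` of the periodic field `u`. -/
def IsWeakPartial (j : Fin 2) (u g : L2) : Prop :=
  ∀ φ : Plane → ℝ, IsPeriodicTest φ →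
    ∫ x, classicalPartial j φ x • u x ∂cellMeasure = -∫ x, φ x • g x ∂cellMeasure

open Classical in
/-- The weak partial derivative `∂_j u` in `L²` where it exists (it is then unique), and `0`
otherwise. -/
def pd (j : Fin 2) (u : L2) : L2 :=
  if h : ∃ g, IsWeakPartial j u g then h.choose else 0

/-- The space `V`: the fields in `H` whose first weak derivatives are in `L²`. -/
def V : Set L2 := {u | u ∈ H ∧ ∀ j, ∃ g, IsWeakPartial j u g}

/-- The domain `D(A)` of the Stokes operator: the fields in `V` whose second weak derivatives are
in `L²`. -/
def DA : Set L2 := {u | u ∈ V ∧ ∀ i j, ∃ g, IsWeakPartial i (pd j u) g}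

/-- The Stokes operator `A u = -ℙ Δ u` (for `u ∈ D(A)`). -/
def stokes (u : L2) : L2 := -leray (∑ j, pd j (pd j u))

/-- The field `(u · ∇) v`, pointwise. -/
def advection (u v : L2) (x : Plane) : Vec := ∑ j, (u x) j • (pd j v) x

open Classical in
/-- The bilinear term `B(u,v) = ℙ((u · ∇) v)` (for `(u · ∇) v` in `L²`, in particular for
`u ∈ D(A)`, `v ∈ V`; `0` otherwise). -/
def B (u v : L2) : L2 :=
  if h : MemLp (advection u v) 2 cellMeasure then leray h.toLp else 0

/-- The phase `k · x`. -/
def phase (k : Fin 2 → ℤ) (x : Plane) : ℝ := ∑ j, (k j : ℝ) * x j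

/-- The fields `cos(k · x) a` and `sin(k · x) a` of wave-number `|k| ≤ N`. -/
def lowModes (N : ℝ) : Set L2 :=
  {w | ∃ (k : Fin 2 → ℤ) (a : Vec), Real.sqrt (∑ j, (k j : ℝ) ^ 2) ≤ N ∧
    ((∀ᵐ x ∂cellMeasure, w x = Real.cos (phase k x) • a) ∨
      ∀ᵐ x ∂cellMeasure, w x = Real.sin (phase k x) • a)}

/-- `P_N`, the orthogonal projection onto the Fourier modes of wave-number `|k| ≤ N`. -/
def P (N : ℝ) : L2 →L[ℝ] L2 := (Submodule.span ℝ (lowModes N)).topologicalClosure.starProjection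

/-- External forces: `f ∈ L^∞(0, ∞; H)`. -/
structure IsForce (f : ℝ → L2) : Prop where
  memLp : MemLp f ⊤ (volume.restrict (Ioi (0 : ℝ)))
  mem_H : ∀ᵐ t ∂volume.restrict (Ioi (0 : ℝ)), f t ∈ H

/-- `|f(t) - g(t)| → 0` as `t → ∞` for elements of `L^∞(0, ∞; H)`: the limit is taken up to null
sets of times, as these functions are only defined almost everywhere. -/
def ForcesConverge (f g : ℝ → L2) : Prop :=
  Tendsto (fun t => ‖f t - g t‖) (atTop ⊓ ae (volume : Measure ℝ)) (𝓝 0)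

/-- `u` is a global strong solution of `du/dt + ν A u + B(u,u) = F`, `u(0) = u₀`:
for every `T > 0` one has `u ∈ C([0,T]; V) ∩ L²(0,T; D(A))` and `du/dt ∈ L²(0,T; H)`, and the
equation holds in `H` at almost every time. Only the values `u(t)` with `t ≥ 0` matter. -/
structure IsStrongSolution (ν : ℝ) (F : ℝ → L2) (u₀ : L2) (u : ℝ → L2) : Prop where
  initial : u 0 = u₀
  mem_V : ∀ t, 0 ≤ t → u t ∈ V
  continuousOn : ContinuousOn u (Ici 0)
  continuousOn_pd : ∀ j, ContinuousOn (fun t => pd j (u t)) (Ici 0)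
  mem_DA : ∀ᵐ t ∂volume.restrict (Ioi (0 : ℝ)), u t ∈ DA
  stokes_memLp : ∀ T : ℝ, 0 < T → MemLp (fun t => stokes (u t)) 2 (volume.restrict (Ioc 0 T))
  equation : ∃ du : ℝ → L2,
    (∀ T : ℝ, 0 < T → MemLp du 2 (volume.restrict (Ioc 0 T))) ∧
    (∀ t, 0 ≤ t → u t = u₀ + ∫ s in (0 : ℝ)..t, du s) ∧
    ∀ᵐ t ∂volume.restrict (Ioi (0 : ℝ)), du t + ν • stokes (u t) + B (u t) (u t) = F t

/-- `(v, u)` is a global strong solution of the Olson--Titi synchronization filter with cut-off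
`N`, force `f` and initial data `(v₀, u₀)`:
`dv/dt + ν A v + B(v,v) = f + P_N B(v,v) - P_N B(u,u)` and `du/dt + ν A u + B(u,u) = f`. -/
def IsSyncFilterSolution (ν N : ℝ) (f : ℝ → L2) (v₀ u₀ : L2) (v u : ℝ → L2) : Prop :=
  IsStrongSolution ν (fun t => f t + P N (B (v t) (v t)) - P N (B (u t) (u t))) v₀ v ∧
    IsStrongSolution ν f u₀ u

/-- The synchronization property of the synchronization filter with force `f`: there is
`N* = N*(u₀, v₀, f) > 0` such that `|v(t) - u(t)| → 0` for every `N ≥ N*`. -/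
def HasSynchronizationProperty (ν : ℝ) (f : ℝ → L2) : Prop :=
  ∀ u₀ ∈ V, ∀ v₀ ∈ V, ∃ Nstar : ℝ, 0 < Nstar ∧ ∀ N : ℝ, Nstar ≤ N →
    ∀ v u : ℝ → L2, IsSyncFilterSolution ν N f v₀ u₀ v u →
      Tendsto (fun t => ‖v t - u t‖) atTop (𝓝 0)

/-- The finite determining modes property of the Navier--Stokes equations for the forces
`f₁, f₂`; the cut-off `N` does not depend on the initial data. -/
def HasFiniteDeterminingModes (ν : ℝ) (f₁ f₂ : ℝ → L2) : Prop :=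
  ∃ N : ℝ, 0 < N ∧ ∀ u₀₁ ∈ V, ∀ u₀₂ ∈ V, ∀ u₁ u₂ : ℝ → L2,
    IsStrongSolution ν f₁ u₀₁ u₁ → IsStrongSolution ν f₂ u₀₂ u₂ →
      Tendsto (fun t => ‖P N (u₁ t) - P N (u₂ t)‖) atTop (𝓝 0) →
      ForcesConverge f₁ f₂ →
      Tendsto (fun t => ‖u₁ t - u₂ t‖) atTop (𝓝 0)

/-- The data of an intertwined Navier--Stokes system: a real `2 × 2` matrix and functions
`F₁, F₂ : V → H` with `F₁(0) = F₂(0) = 0`. -/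
structure Intertwinement where
  M : Matrix (Fin 2) (Fin 2) ℝ
  F₁ : L2 → L2
  F₂ : L2 → L2
  mapsTo₁ : ∀ v ∈ V, F₁ v ∈ H
  mapsTo₂ : ∀ v ∈ V, F₂ v ∈ H
  zero₁ : F₁ 0 = 0
  zero₂ : F₂ 0 = 0

/-- `(v₁, v₂)` is a global strong solution of the intertwined system
`dvᵢ/dt + ν A vᵢ + B(vᵢ,vᵢ) = gᵢ + mᵢ₁ F₁(v₁) + mᵢ₂ F₂(v₂)`, `vᵢ(0) = v₀ᵢ`, `i = 1, 2`. -/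
def Intertwinement.IsSolution (I : Intertwinement) (ν : ℝ) (g₁ g₂ : ℝ → L2) (v₀₁ v₀₂ : L2)
    (v₁ v₂ : ℝ → L2) : Prop :=
  IsStrongSolution ν (fun t => g₁ t + I.M 0 0 • I.F₁ (v₁ t) + I.M 0 1 • I.F₂ (v₂ t)) v₀₁ v₁ ∧
    IsStrongSolution ν (fun t => g₂ t + I.M 1 0 • I.F₁ (v₁ t) + I.M 1 1 • I.F₂ (v₂ t)) v₀₂ v₂

/-- Finite-dimensionally assisted self-synchronization of an intertwinement, for the external
forces `g₁, g₂`; the cut-off `N` does not depend on the initial data. -/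
def Intertwinement.IsFinDimAssistedSelfSynchronous (I : Intertwinement) (ν : ℝ)
    (g₁ g₂ : ℝ → L2) : Prop :=
  ∃ N : ℝ, 0 < N ∧ ∀ v₀₁ ∈ V, ∀ v₀₂ ∈ V, ∀ v₁ v₂ : ℝ → L2,
    I.IsSolution ν g₁ g₂ v₀₁ v₀₂ v₁ v₂ →
      Tendsto (fun t => ‖P N (v₁ t) - P N (v₂ t)‖) atTop (𝓝 0) →
      ForcesConverge g₁ g₂ →
      Tendsto (fun t => ‖v₁ t - v₂ t‖) atTop (𝓝 0)

/-- The trivial intertwinement `F ≡ 0` (with any matrix `M`). -/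
def Intertwinement.trivial (M : Matrix (Fin 2) (Fin 2) ℝ) : Intertwinement where
  M := M
  F₁ := fun _ => 0
  F₂ := fun _ => 0
  mapsTo₁ := fun _ _ => H.zero_mem
  mapsTo₂ := fun _ _ => H.zero_mem
  zero₁ := rfl
  zero₂ := rfl

end NavierStokes2D

end

open MeasureTheory Set Filter Topology
open scoped ContDiff

noncomputable section

namespace NavierStokes2D

section Evolution

variable {E : Type*} [NormedAddCommGroup E] [InnerProductSpace ℝ E]

theorem absolutelyContinuousOnInterval_norm_sq {u du : ℝ → E} {u₀ : E} {T : ℝ} (hT : 0 ≤ T)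
    (hdu : IntervalIntegrable du volume 0 T)
    (hu : ∀ t, 0 ≤ t → u t = u₀ + ∫ s in (0 : ℝ)..t, du s) :
    AbsolutelyContinuousOnInterval (fun t => ‖u t‖ ^ 2) 0 T := by
  have hG := hdu.norm.absolutelyContinuousOnInterval_intervalIntegral (c := 0) (by simp)
  have hcont : ContinuousOn u (Icc 0 T) := by
    have h := intervalIntegral.continuousOn_primitive_interval' hdu (left_mem_uIcc)
    rw [uIcc_of_le hT] at h
    exact (continuousOn_const.add h).congr fun t ht => hu t ht.1
  obtain ⟨M, hM⟩ := isCompact_Icc.exists_bound_of_continuousOn hcont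
  have hsub : ∀ a ∈ Icc 0 T, ∀ b ∈ Icc 0 T, IntervalIntegrable du volume a b := fun a ha b hb =>
    hdu.mono_set (by rw [uIcc_of_le hT]; exact uIcc_subset_Icc ha hb)
  have key : ∀ a ∈ Icc 0 T, ∀ b ∈ Icc 0 T, dist (‖u a‖ ^ 2) (‖u b‖ ^ 2) ≤
      2 * M * dist (∫ v in (0 : ℝ)..a, ‖du v‖) (∫ v in (0 : ℝ)..b, ‖du v‖) := by
    intro a ha b hb
    have h0 : (0 : ℝ) ∈ Icc 0 T := ⟨le_rfl, hT⟩
    have e1 : u a - u b = ∫ v in b..a, du v := by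
      rw [hu a ha.1, hu b hb.1, add_sub_add_left_eq_sub,
        intervalIntegral.integral_interval_sub_left (hsub _ h0 _ ha) (hsub _ h0 _ hb)]
    have e2 : (∫ v in (0 : ℝ)..a, ‖du v‖) - (∫ v in (0 : ℝ)..b, ‖du v‖) =
        ∫ v in b..a, ‖du v‖ :=
      intervalIntegral.integral_interval_sub_left (hsub _ h0 _ ha).norm (hsub _ h0 _ hb).norm
    rw [Real.dist_eq, Real.dist_eq, e2]
    have e3 : ‖u a - u b‖ ≤ |∫ v in b..a, ‖du v‖| := by
      rw [e1]; exact intervalIntegral.norm_integral_le_abs_integral_norm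
    have e4 : |‖u a‖ ^ 2 - ‖u b‖ ^ 2| = |‖u a‖ + ‖u b‖| * |‖u a‖ - ‖u b‖| := by
      rw [← abs_mul]; congr 1; ring
    rw [e4]
    have hMa := hM a ha
    have hMb := hM b hb
    have hn : |‖u a‖ + ‖u b‖| ≤ 2 * M := by
      rw [abs_of_nonneg (by positivity)]; linarith
    exact mul_le_mul hn ((abs_norm_sub_norm_le _ _).trans e3) (abs_nonneg _)
      ((norm_nonneg _).trans hMa |> fun h => by linarith)
  unfold AbsolutelyContinuousOnInterval at hG ⊢
  refine squeeze_zero' (Eventually.of_forall fun E => Finset.sum_nonneg fun i _ => dist_nonneg) ?_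
    (by simpa using hG.const_mul (2 * M))
  have hmem : ∀ᶠ E in AbsolutelyContinuousOnInterval.totalLengthFilter ⊓
      𝓟 (AbsolutelyContinuousOnInterval.disjWithin 0 T),
      E ∈ AbsolutelyContinuousOnInterval.disjWithin 0 T :=
    eventually_inf_principal.2 (Eventually.of_forall fun _ h => h)
  filter_upwards [hmem] with E hE
  rw [Finset.mul_sum]
  refine Finset.sum_le_sum fun i hi => ?_
  have := hE.1 i hi
  rw [uIcc_of_le hT] at this
  exact key _ this.1 _ this.2

variable [CompleteSpace E]

theorem ae_hasDerivAt_norm_sq {u du : ℝ → E} {u₀ : E} {T : ℝ} (hT : 0 ≤ T)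
    (hdu : IntervalIntegrable du volume 0 T)
    (hu : ∀ t, 0 ≤ t → u t = u₀ + ∫ s in (0 : ℝ)..t, du s) :
    ∀ᵐ x, x ∈ Ioo 0 T → HasDerivAt (fun t => ‖u t‖ ^ 2) (2 * inner ℝ (u x) (du x)) x := by
  filter_upwards [hdu.ae_hasDerivAt_integral] with x hx hxI
  have h1 := hx (by rw [uIcc_of_le hT]; exact Ioo_subset_Icc_self hxI) 0 (by simp)
  have h2 : HasDerivAt u (du x) x := by
    refine (h1.const_add u₀).congr_of_eventuallyEq ?_
    filter_upwards [lt_mem_nhds hxI.1] with t ht using hu t ht.le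
  exact h2.norm_sq

/-- The energy identity for a primitive of an integrable function. -/
theorem norm_sq_sub_norm_sq_eq_integral {u du : ℝ → E} {u₀ : E} {s t : ℝ} (hs : 0 ≤ s)
    (hst : s ≤ t) (hdu : IntervalIntegrable du volume 0 t)
    (hu : ∀ t, 0 ≤ t → u t = u₀ + ∫ s in (0 : ℝ)..t, du s) :
    ‖u t‖ ^ 2 - ‖u s‖ ^ 2 = ∫ r in s..t, 2 * inner ℝ (u r) (du r) := by
  have hT : 0 ≤ t := hs.trans hst
  have hac := (absolutelyContinuousOnInterval_norm_sq hT hdu hu).mono (c := s) (d := t)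
    (by rw [uIcc_of_le hT, uIcc_of_le hst]; exact Icc_subset_Icc_left hs)
  rw [← hac.integral_deriv_eq_sub]
  refine intervalIntegral.integral_congr_ae ?_
  have hne : ∀ᵐ x : ℝ, x ≠ t := by simp [ae_iff, measure_singleton]
  filter_upwards [ae_hasDerivAt_norm_sq hT hdu hu, hne] with x hx hxt hxI
  rw [uIoc_of_le hst] at hxI
  exact (hx ⟨hs.trans_lt hxI.1, lt_of_le_of_ne hxI.2 hxt⟩).deriv

theorem intervalIntegrable_inner_deriv {u du : ℝ → E} {u₀ : E} {s t : ℝ} (hs : 0 ≤ s)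
    (hst : s ≤ t) (hdu : IntervalIntegrable du volume 0 t)
    (hu : ∀ t, 0 ≤ t → u t = u₀ + ∫ s in (0 : ℝ)..t, du s) :
    IntervalIntegrable (fun r => 2 * inner ℝ (u r) (du r)) volume s t := by
  have hT : 0 ≤ t := hs.trans hst
  have hac := (absolutelyContinuousOnInterval_norm_sq hT hdu hu).mono (c := s) (d := t)
    (by rw [uIcc_of_le hT, uIcc_of_le hst]; exact Icc_subset_Icc_left hs)
  refine hac.intervalIntegrable_deriv.congr_ae ?_
  rw [EventuallyEq, ae_restrict_iff' measurableSet_uIoc]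
  have hne : ∀ᵐ x : ℝ, x ≠ t := by simp [ae_iff, measure_singleton]
  filter_upwards [ae_hasDerivAt_norm_sq hT hdu hu, hne] with x hx hxt hxI
  rw [uIoc_of_le hst] at hxI
  exact (hx ⟨hs.trans_lt hxI.1, lt_of_le_of_ne hxI.2 hxt⟩).deriv

end Evolution

/-- A Gronwall inequality for a linear integral inequality whose coefficient `α` is only bounded
below on average. -/
theorem le_of_integral_inequality_of_average {φ α : ℝ → ℝ} {s₀ ε κ C : ℝ} (hφ : Continuous φ)
    (hα : Continuous α) (hε : 0 ≤ ε) (hκ : 0 < κ)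
    (h : ∀ s t, s₀ ≤ s → s ≤ t → φ t - φ s ≤ ∫ r in s..t, (ε - α r * φ r))
    (hC : ∀ s t, s₀ ≤ s → s ≤ t → κ * (t - s) - C ≤ ∫ r in s..t, α r) {t : ℝ} (ht : s₀ ≤ t) :
    φ t ≤ Real.exp C * (Real.exp (-(κ * (t - s₀))) * |φ s₀| + ε / κ) := by
  have hii : ∀ a b, IntervalIntegrable α volume a b := fun a b => hα.intervalIntegrable a b
  set A : ℝ → ℝ := fun t => ∫ r in s₀..t, α r with hA
  have hAd : ∀ x, HasDerivAt A (α x) x := fun x =>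
    intervalIntegral.integral_hasDerivAt_right (hii _ _)
      (hα.stronglyMeasurableAtFilter _ _) hα.continuousAt
  have hAc : Continuous A := continuous_iff_continuousAt.2 fun x => (hAd x).continuousAt
  have hAsub : ∀ s t, A t - A s = ∫ r in s..t, α r := fun s t =>
    intervalIntegral.integral_interval_sub_left (hii _ _) (hii _ _)
  have hEc : Continuous fun r => Real.exp (A r) := Real.continuous_exp.comp hAc
  have hId : ∀ x, HasDerivAt (fun t => ∫ r in s₀..t, Real.exp (A r)) (Real.exp (A x)) x := fun x =>
    intervalIntegral.integral_hasDerivAt_right (hEc.intervalIntegrable _ _)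
      (hEc.stronglyMeasurableAtFilter _ _) hEc.continuousAt
  have main : ∀ δ, ε < δ →
      φ t ≤ Real.exp C * (Real.exp (-(κ * (t - s₀))) * |φ s₀| + δ / κ) := by
    intro δ hδ
    set Bd : ℝ → ℝ := fun t => Real.exp (-A t) * (φ s₀ + δ * ∫ r in s₀..t, Real.exp (A r)) with hBd
    have hBdd : ∀ x, HasDerivAt Bd (δ - α x * Bd x) x := by
      intro x
      have h1 := (hAd x).neg.exp.mul (((hId x).const_mul δ).const_add (φ s₀))
      refine h1.congr_deriv ?_
      simp only [hBd, Pi.neg_apply]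
      have : Real.exp (-A x) * (δ * Real.exp (A x)) = δ := by
        rw [mul_left_comm, ← Real.exp_add]; simp
      rw [this]; ring
    have hle : φ t ≤ Bd t := by
      refine image_le_of_liminf_slope_right_lt_deriv_boundary (a := s₀) (b := t)
        (f' := fun x => ε - α x * φ x) hφ.continuousOn ?_ ?_ hBdd ?_ ⟨ht, le_rfl⟩
      · intro x hx r hr
        have hc : Continuous fun r => ε - α r * φ r := by fun_prop
        have hd : HasDerivAt (fun t => ∫ r in x..t, (ε - α r * φ r)) (ε - α x * φ x) x :=
          intervalIntegral.integral_hasDerivAt_right (hc.intervalIntegrable _ _)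
            (hc.stronglyMeasurableAtFilter _ _) hc.continuousAt
        have hs := (hasDerivWithinAt_iff_tendsto_slope' (s := Ioi x) (by simp)).1
          (hd.hasDerivWithinAt (s := Ioi x))
        refine Eventually.frequently ?_
        filter_upwards [hs.eventually (gt_mem_nhds hr), self_mem_nhdsWithin] with z hz hzx
        refine lt_of_le_of_lt ?_ hz
        rw [slope_def_field, slope_def_field]
        have hzx' : x < z := hzx
        have := h x z hx.1 hzx'.le
        simp only [intervalIntegral.integral_same, sub_zero]
        gcongr
      · simp [hBd, hA]
      · intro x _ hx
        simp only [hx]; linarith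
    refine hle.trans ?_
    have e1 : Bd t = Real.exp (-A t) * φ s₀ + δ * ∫ r in s₀..t, Real.exp (A r - A t) := by
      simp only [hBd, Real.exp_sub, intervalIntegral.integral_div, Real.exp_neg]
      ring
    have hexp : ∀ s ∈ Icc s₀ t, Real.exp (A s - A t) ≤ Real.exp C * Real.exp (κ * (s - t)) := by
      intro s hs
      rw [← Real.exp_add]
      refine Real.exp_le_exp.2 ?_
      have := hC s t hs.1 hs.2
      rw [← hAsub] at this
      linarith
    have hint : ∫ r in s₀..t, Real.exp (A r - A t) ≤ Real.exp C * (1 / κ) := by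
      have h1 : ∫ r in s₀..t, Real.exp (A r - A t) ≤
          ∫ r in s₀..t, Real.exp C * Real.exp (κ * (r - t)) :=
        intervalIntegral.integral_mono_on ht (Continuous.intervalIntegrable (by fun_prop) _ _)
          (Continuous.intervalIntegrable (by fun_prop) _ _) hexp
      refine h1.trans ?_
      rw [intervalIntegral.integral_const_mul]
      refine mul_le_mul_of_nonneg_left ?_ (Real.exp_pos _).le
      have h2 : ∀ x, HasDerivAt (fun r => Real.exp (κ * (r - t)) / κ)
          (Real.exp (κ * (x - t))) x := by
        intro x
        have := ((((hasDerivAt_id x).sub_const t).const_mul κ).exp).div_const κ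
        refine this.congr_deriv ?_
        field_simp
        simp
      rw [intervalIntegral.integral_eq_sub_of_hasDerivAt (fun x _ => h2 x)
        (Continuous.intervalIntegrable (by fun_prop) _ _)]
      simp only [sub_self, mul_zero, Real.exp_zero]
      have : 0 ≤ Real.exp (κ * (s₀ - t)) / κ := by positivity
      linarith
    have hfirst : Real.exp (-A t) * φ s₀ ≤ Real.exp C * (Real.exp (-(κ * (t - s₀))) * |φ s₀|) := by
      have h1 := hexp s₀ ⟨le_rfl, ht⟩
      have h0 : A s₀ = 0 := by simp [hA]
      rw [h0, zero_sub] at h1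
      rw [← mul_assoc]
      have h2 : κ * (s₀ - t) = -(κ * (t - s₀)) := by ring
      rw [h2] at h1
      exact (mul_le_mul_of_nonneg_left (le_abs_self _) (Real.exp_pos _).le).trans
        (mul_le_mul_of_nonneg_right h1 (abs_nonneg _))
    rw [e1, mul_add]
    refine add_le_add hfirst ?_
    have := mul_le_mul_of_nonneg_left hint (hε.trans hδ.le)
    calc _ ≤ _ := this
      _ = _ := by ring
  refine ge_of_tendsto (x := 𝓝[>] ε)
    (f := fun δ => Real.exp C * (Real.exp (-(κ * (t - s₀))) * |φ s₀| + δ / κ)) ?_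
    (by filter_upwards [self_mem_nhdsWithin] with δ hδ using main δ hδ)
  refine Tendsto.mono_left (Continuous.tendsto (by fun_prop) ε) nhdsWithin_le_nhds

/-- Lebesgue measure on the interval `(0, 2π)`. -/
def intervalMeasure : Measure ℝ := volume.restrict (Ioo (0 : ℝ) (2 * Real.pi))

instance : IsFiniteMeasure intervalMeasure := by
  unfold intervalMeasure; infer_instance

theorem cellMeasure_eq_pi : cellMeasure = Measure.pi fun _ => intervalMeasure := by
  unfold cellMeasure cell intervalMeasure
  rw [volume_pi, Measure.restrict_pi_pi]

instance : IsFiniteMeasure cellMeasure := by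
  rw [cellMeasure_eq_pi]; infer_instance

theorem measurePreserving_cell :
    MeasurePreserving (MeasurableEquiv.finTwoArrow (α := ℝ)) cellMeasure
      (intervalMeasure.prod intervalMeasure) := by
  rw [cellMeasure_eq_pi]; exact measurePreserving_finTwoArrow _

theorem lintegral_cell (F : Plane → ENNReal) :
    ∫⁻ x, F x ∂cellMeasure =
      ∫⁻ p : ℝ × ℝ, F ![p.1, p.2] ∂(intervalMeasure.prod intervalMeasure) := by
  rw [← measurePreserving_cell.lintegral_comp_emb (MeasurableEquiv.measurableEmbedding _)]
  refine lintegral_congr fun x => ?_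
  congr 1
  ext i; fin_cases i <;> rfl

theorem integrable_intervalMeasure {g : ℝ → ℝ} (hg : Continuous g) :
    Integrable g intervalMeasure :=
  (hg.integrableOn_Icc (μ := volume)).mono_set Ioo_subset_Icc_self

/-- A one-dimensional Sobolev inequality on the period. -/
theorem enorm_sq_le_lintegral {g g' : ℝ → ℝ} (hg : ∀ x, HasDerivAt g (g' x) x)
    (hg' : Continuous g') {s : ℝ} (hs : s ∈ Ioo (0 : ℝ) (2 * Real.pi)) :
    ‖g s‖ₑ ^ 2 ≤ ∫⁻ x, (‖g x‖ₑ ^ 2 + 2 * (‖g x‖ₑ * ‖g' x‖ₑ)) ∂intervalMeasure := by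
  have hgc : Continuous g := continuous_iff_continuousAt.2 fun x => (hg x).continuousAt
  have hc1 : Continuous fun x => 2 * (|g x| * |g' x|) := by fun_prop
  have hc2 : Continuous fun x => g x ^ 2 := by fun_prop
  set D := ∫ x, 2 * (|g x| * |g' x|) ∂intervalMeasure with hD
  have hpt : ∀ σ ∈ Ioo (0 : ℝ) (2 * Real.pi), g s ^ 2 ≤ g σ ^ 2 + D := by
    intro σ hσ
    have h1 : g s ^ 2 - g σ ^ 2 = ∫ x in σ..s, 2 * (g x * g' x) := by
      rw [intervalIntegral.integral_eq_sub_of_hasDerivAt (f := fun x => g x ^ 2)]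
      · intro x _
        refine ((hg x).pow 2).congr_deriv ?_
        simp; ring
      · exact Continuous.intervalIntegrable (by fun_prop) _ _
    have h2 : ∫ x in σ..s, 2 * (g x * g' x) ≤ D := by
      refine (Real.le_norm_self _).trans ?_
      refine (intervalIntegral.norm_integral_le_integral_norm_uIoc (μ := volume)
        (f := fun x => 2 * (g x * g' x))).trans ?_
      have : ∀ x, ‖2 * (g x * g' x)‖ = 2 * (|g x| * |g' x|) := fun x => by simp
      simp only [this]
      refine setIntegral_mono_set (integrable_intervalMeasure hc1)
        (Eventually.of_forall fun x => by positivity) ?_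
      refine (LE.le.eventuallyLE ?_)
      intro x hx
      rw [mem_uIoc] at hx
      rcases hx with hx | hx
      · exact ⟨hσ.1.trans hx.1, hx.2.trans_lt hs.2⟩
      · exact ⟨hs.1.trans hx.1, hx.2.trans_lt hσ.2⟩
    linarith
  have hpi : (1 : ℝ) ≤ 2 * Real.pi := by linarith [Real.pi_gt_three]
  have hvol : intervalMeasure.real univ = 2 * Real.pi := by
    simp [intervalMeasure, measureReal_def, Real.pi_pos.le]
  have hmean : g s ^ 2 ≤ ∫ x, (g x ^ 2 + 2 * (|g x| * |g' x|)) ∂intervalMeasure := by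
    rw [integral_add (integrable_intervalMeasure hc2) (integrable_intervalMeasure hc1), ← hD]
    have h3 : ∫ x, (g s ^ 2 - D) ∂intervalMeasure ≤ ∫ x, g x ^ 2 ∂intervalMeasure := by
      refine integral_mono_ae (integrable_const _) (integrable_intervalMeasure hc2) ?_
      filter_upwards [ae_restrict_mem (μ := volume) measurableSet_Ioo] with σ hσ
      linarith [hpt σ hσ]
    rw [integral_const, hvol, smul_eq_mul] at h3
    have h4 : 0 ≤ ∫ x, g x ^ 2 ∂intervalMeasure := integral_nonneg fun x => sq_nonneg _
    by_cases h5 : g s ^ 2 - D ≤ 0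
    · linarith
    · have := le_mul_of_one_le_left (le_of_not_ge h5) hpi
      linarith
  have hrhs : ∫⁻ x, (‖g x‖ₑ ^ 2 + 2 * (‖g x‖ₑ * ‖g' x‖ₑ)) ∂intervalMeasure =
      ENNReal.ofReal (∫ x, (g x ^ 2 + 2 * (|g x| * |g' x|)) ∂intervalMeasure) := by
    rw [ofReal_integral_eq_lintegral_ofReal (integrable_intervalMeasure (by fun_prop))
      (Eventually.of_forall fun x => by positivity)]
    refine lintegral_congr fun x => ?_
    rw [ENNReal.ofReal_add (by positivity) (by positivity), ENNReal.ofReal_mul (by norm_num),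
      ENNReal.ofReal_mul (by positivity), ← sq_abs, ENNReal.ofReal_pow (by positivity)]
    simp [Real.enorm_eq_ofReal_abs]
  rw [hrhs, Real.enorm_eq_ofReal_abs, ← ENNReal.ofReal_pow (abs_nonneg _), sq_abs]
  exact ENNReal.ofReal_le_ofReal hmean

theorem hasDerivAt_left {φ : Plane → ℝ} (hφ : ContDiff ℝ 1 φ) (x y : ℝ) :
    HasDerivAt (fun s => φ ![s, y]) (classicalPartial 0 φ ![x, y]) x := by
  have h1 : HasFDerivAt φ (fderiv ℝ φ ![x, y]) ![x, y] :=
    (hφ.differentiable (by simp) _).hasFDerivAt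
  refine h1.comp_hasDerivAt x ?_
  rw [hasDerivAt_pi, Fin.forall_fin_two]
  exact ⟨by simpa using hasDerivAt_id' x, by simpa using hasDerivAt_const x y⟩

theorem hasDerivAt_right {φ : Plane → ℝ} (hφ : ContDiff ℝ 1 φ) (x y : ℝ) :
    HasDerivAt (fun s => φ ![x, s]) (classicalPartial 1 φ ![x, y]) y := by
  have h1 : HasFDerivAt φ (fderiv ℝ φ ![x, y]) ![x, y] :=
    (hφ.differentiable (by simp) _).hasFDerivAt
  refine h1.comp_hasDerivAt y ?_
  rw [hasDerivAt_pi, Fin.forall_fin_two]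
  exact ⟨by simpa using hasDerivAt_const y x, by simpa using hasDerivAt_id' y⟩

theorem continuous_classicalPartial {φ : Plane → ℝ} (hφ : ContDiff ℝ 1 φ) (j : Fin 2) :
    Continuous (classicalPartial j φ) :=
  (hφ.continuous_fderiv (by simp)).clm_apply continuous_const

/-- Ladyzhenskaya's inequality for smooth functions. -/
theorem lintegral_pow_four_le {φ : Plane → ℝ} (hφ : ContDiff ℝ 1 φ) :
    ∫⁻ x, ‖φ x‖ₑ ^ 4 ∂cellMeasure ≤
      (∫⁻ x, (‖φ x‖ₑ ^ 2 + 2 * (‖φ x‖ₑ * ‖classicalPartial 0 φ x‖ₑ)) ∂cellMeasure) *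
      ∫⁻ x, (‖φ x‖ₑ ^ 2 + 2 * (‖φ x‖ₑ * ‖classicalPartial 1 φ x‖ₑ)) ∂cellMeasure := by
  have hφc := hφ.continuous
  have hm : Continuous fun p : ℝ × ℝ => (![p.1, p.2] : Plane) := by fun_prop
  rw [lintegral_cell, lintegral_cell, lintegral_cell]
  set F := fun (j : Fin 2) (p : ℝ × ℝ) => ‖φ ![p.1, p.2]‖ₑ ^ 2 +
      2 * (‖φ ![p.1, p.2]‖ₑ * ‖classicalPartial j φ ![p.1, p.2]‖ₑ) with hF
  have hFm : ∀ j, Measurable (F j) := fun j => by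
    have h1 : Measurable fun p : ℝ × ℝ => φ ![p.1, p.2] := (hφc.comp hm).measurable
    have h2 : Measurable fun p : ℝ × ℝ => classicalPartial j φ ![p.1, p.2] :=
      ((continuous_classicalPartial hφ j).comp hm).measurable
    exact (h1.enorm.pow_const 2).add ((h1.enorm.mul h2.enorm).const_mul 2)
  have hA : Measurable fun y => ∫⁻ x, F 0 (x, y) ∂intervalMeasure :=
    (hFm 0).lintegral_prod_left'
  have hB : Measurable fun x => ∫⁻ y, F 1 (x, y) ∂intervalMeasure :=
    (hFm 1).lintegral_prod_right'
  change _ ≤ (∫⁻ p, F 0 p ∂_) * ∫⁻ p, F 1 p ∂_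
  rw [lintegral_prod_symm _ (hFm 0).aemeasurable, lintegral_prod _ (hFm 1).aemeasurable, mul_comm,
    ← lintegral_prod_mul hB.aemeasurable hA.aemeasurable]
  refine lintegral_mono_ae ?_
  have hmem : ∀ᵐ p : ℝ × ℝ ∂(intervalMeasure.prod intervalMeasure),
      p ∈ Ioo (0 : ℝ) (2 * Real.pi) ×ˢ Ioo (0 : ℝ) (2 * Real.pi) := by
    unfold intervalMeasure
    rw [Measure.prod_restrict]
    exact ae_restrict_mem (measurableSet_Ioo.prod measurableSet_Ioo)
  filter_upwards [hmem] with p hp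
  have h1 := enorm_sq_le_lintegral (fun x => hasDerivAt_left hφ x p.2)
    ((continuous_classicalPartial hφ 0).comp (hm.comp (continuous_id.prodMk continuous_const)))
    hp.1
  have h2 := enorm_sq_le_lintegral (fun y => hasDerivAt_right hφ p.1 y)
    ((continuous_classicalPartial hφ 1).comp (hm.comp (continuous_const.prodMk continuous_id)))
    hp.2
  calc ‖φ ![p.1, p.2]‖ₑ ^ 4 = ‖φ ![p.1, p.2]‖ₑ ^ 2 * ‖φ ![p.1, p.2]‖ₑ ^ 2 := by ring
    _ ≤ _ := mul_le_mul' h2 h1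

/-- The cosine coefficient `∫ cos(k · x) f(x) dx`. -/
def cosCoeff (f : Plane → ℝ) (k : Fin 2 → ℤ) : ℝ := ∫ x, Real.cos (phase k x) * f x ∂cellMeasure

/-- The sine coefficient `∫ sin(k · x) f(x) dx`. -/
def sinCoeff (f : Plane → ℝ) (k : Fin 2 → ℤ) : ℝ := ∫ x, Real.sin (phase k x) * f x ∂cellMeasure

/-- The partial sum of the Fourier series of `f` over the modes in `s`. -/
def fourierSum (s : Finset (Fin 2 → ℤ)) (f : Plane → ℝ) (x : Plane) : ℝ :=
  ∑ k ∈ s, ((2 * Real.pi)⁻¹ ^ 2 * cosCoeff f k * Real.cos (phase k x) +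
    (2 * Real.pi)⁻¹ ^ 2 * sinCoeff f k * Real.sin (phase k x))

theorem hasFDerivAt_phase (k : Fin 2 → ℤ) (x : Plane) :
    HasFDerivAt (phase k) (∑ j, (k j : ℝ) •
      ContinuousLinearMap.proj (R := ℝ) (φ := fun _ : Fin 2 => ℝ) j) x := by
  unfold phase
  refine HasFDerivAt.fun_sum fun j _ => ?_
  exact ((ContinuousLinearMap.proj (R := ℝ) (φ := fun _ : Fin 2 => ℝ) j).hasFDerivAt).const_mul _

theorem contDiff_phase (k : Fin 2 → ℤ) : ContDiff ℝ ∞ (phase k) := by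
  unfold phase; fun_prop

theorem continuous_phase (k : Fin 2 → ℤ) : Continuous (phase k) := (contDiff_phase k).continuous

theorem phase_add_period (k : Fin 2 → ℤ) (x : Plane) (m : Fin 2 → ℤ) :
    phase k (fun j => x j + 2 * Real.pi * (m j : ℝ)) =
      phase k x + ((∑ j, k j * m j : ℤ) : ℝ) * (2 * Real.pi) := by
  simp only [phase, Fin.sum_univ_two]; push_cast; ring

theorem classicalPartial_phase_apply (k : Fin 2 → ℤ) (j : Fin 2) :
    (∑ i, (k i : ℝ) • ContinuousLinearMap.proj (R := ℝ) (φ := fun _ : Fin 2 => ℝ) i)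
      (Pi.single j 1) = k j := by
  fin_cases j <;> simp [Fin.sum_univ_two]

theorem isPeriodicTest_cos (k : Fin 2 → ℤ) : IsPeriodicTest fun x => Real.cos (phase k x) :=
  ⟨Real.contDiff_cos.comp (contDiff_phase k), fun x m => by
    rw [phase_add_period, Real.cos_add_int_mul_two_pi]⟩

theorem isPeriodicTest_sin (k : Fin 2 → ℤ) : IsPeriodicTest fun x => Real.sin (phase k x) :=
  ⟨Real.contDiff_sin.comp (contDiff_phase k), fun x m => by
    rw [phase_add_period, Real.sin_add_int_mul_two_pi]⟩

theorem classicalPartial_cos (k : Fin 2 → ℤ) (j : Fin 2) (x : Plane) :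
    classicalPartial j (fun x => Real.cos (phase k x)) x = -(k j * Real.sin (phase k x)) := by
  rw [classicalPartial, ((hasFDerivAt_phase k x).cos).fderiv, _root_.smul_apply,
    classicalPartial_phase_apply, smul_eq_mul]
  ring

theorem classicalPartial_sin (k : Fin 2 → ℤ) (j : Fin 2) (x : Plane) :
    classicalPartial j (fun x => Real.sin (phase k x)) x = k j * Real.cos (phase k x) := by
  rw [classicalPartial, ((hasFDerivAt_phase k x).sin).fderiv, _root_.smul_apply,
    classicalPartial_phase_apply, smul_eq_mul]
  ring

theorem isPeriodicTest_fourierSum (s : Finset (Fin 2 → ℤ)) (f : Plane → ℝ) :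
    IsPeriodicTest (fourierSum s f) where
  smooth := by
    unfold fourierSum
    refine ContDiff.sum fun k _ => ?_
    exact (contDiff_const.mul (isPeriodicTest_cos k).smooth).add
      (contDiff_const.mul (isPeriodicTest_sin k).smooth)
  periodic x m := by
    unfold fourierSum
    refine Finset.sum_congr rfl fun k _ => ?_
    rw [(isPeriodicTest_cos k).periodic x m, (isPeriodicTest_sin k).periodic x m]

theorem classicalPartial_fourierSum {f g : Plane → ℝ} {j : Fin 2}
    (hc : ∀ k, cosCoeff g k = k j * sinCoeff f k) (hs : ∀ k, sinCoeff g k = -(k j * cosCoeff f k))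
    (s : Finset (Fin 2 → ℤ)) (x : Plane) :
    classicalPartial j (fourierSum s f) x = fourierSum s g x := by
  have h : HasFDerivAt (fourierSum s f) (∑ k ∈ s,
      (((2 * Real.pi)⁻¹ ^ 2 * cosCoeff f k) • fderiv ℝ (fun x => Real.cos (phase k x)) x +
        ((2 * Real.pi)⁻¹ ^ 2 * sinCoeff f k) • fderiv ℝ (fun x => Real.sin (phase k x)) x)) x := by
    unfold fourierSum
    refine HasFDerivAt.fun_sum fun k _ => ?_
    exact (((hasFDerivAt_phase k x).cos.differentiableAt.hasFDerivAt).const_mul _).add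
      (((hasFDerivAt_phase k x).sin.differentiableAt.hasFDerivAt).const_mul _)
  rw [classicalPartial, h.fderiv, _root_.sum_apply, fourierSum]
  refine Finset.sum_congr rfl fun k _ => ?_
  have h1 := classicalPartial_cos k j x
  have h2 := classicalPartial_sin k j x
  rw [classicalPartial] at h1 h2
  rw [_root_.add_apply, _root_.smul_apply, _root_.smul_apply,
    h1, h2, hc, hs, smul_eq_mul, smul_eq_mul]
  ring

section Torus

local instance measureSpaceUnitAddCircle : MeasureSpace UnitAddCircle :=
  ⟨AddCircle.haarAddCircle⟩

local instance isAddHaarMeasureUnitAddCircle :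
    Measure.IsAddHaarMeasure (volume : Measure UnitAddCircle) :=
  inferInstanceAs (Measure.IsAddHaarMeasure AddCircle.haarAddCircle)

local instance isProbabilityMeasureUnitAddCircle :
    IsProbabilityMeasure (volume : Measure UnitAddCircle) :=
  inferInstanceAs (IsProbabilityMeasure AddCircle.haarAddCircle)

/-- The representative in `(0, 2π]` of a point of the unit circle, rescaled. -/
def circleLift (y : UnitAddCircle) : ℝ := 2 * Real.pi * (AddCircle.equivIoc 1 0 y : ℝ)

theorem measurable_circleLift : Measurable circleLift :=
  (measurable_subtype_coe.comp (AddCircle.measurableEquivIoc 1 0).measurable).const_mul _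

instance : IsFiniteMeasure (ENNReal.ofReal (2 * Real.pi)⁻¹ • intervalMeasure) :=
  Measure.smul_finite _ ENNReal.ofReal_ne_top

theorem measurePreserving_circleLift :
    MeasurePreserving circleLift volume (ENNReal.ofReal (2 * Real.pi)⁻¹ • intervalMeasure) := by
  refine ⟨measurable_circleLift, ?_⟩
  have h1 := (AddCircle.measurePreserving_mk 1 0).map_eq
  have h2 : (volume : Measure UnitAddCircle) =
      Measure.map (QuotientAddGroup.mk : ℝ → UnitAddCircle) (volume.restrict (Ioc 0 (0 + 1))) := by
    rw [h1]; simp [volume, AddCircle.haarAddCircle]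
  have hpi : (2 * Real.pi) ≠ 0 := by positivity
  rw [h2, Measure.map_map measurable_circleLift AddCircle.measurable_mk']
  have h3 : Measure.map (circleLift ∘ (QuotientAddGroup.mk : ℝ → UnitAddCircle))
      (volume.restrict (Ioc 0 (0 + 1))) =
      Measure.map (fun x => 2 * Real.pi * x) (volume.restrict (Ioc 0 (0 + 1))) := by
    refine Measure.map_congr ?_
    filter_upwards [ae_restrict_mem measurableSet_Ioc] with x hx
    simp only [Function.comp, circleLift]
    congr 1
    exact congrArg Subtype.val (AddCircle.equivIoc_coe_eq hx)
  rw [h3]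
  have h4 : (fun x : ℝ => 2 * Real.pi * x) ⁻¹' (Ioc 0 (2 * Real.pi)) = Ioc 0 (0 + 1) := by
    ext x
    simp only [mem_preimage, mem_Ioc, zero_add]
    have := Real.pi_pos
    constructor
    · rintro ⟨a, b⟩; constructor
      · by_contra h; nlinarith
      · by_contra h; nlinarith
    · rintro ⟨a, b⟩; constructor
      · positivity
      · nlinarith
  rw [← h4, ← Measure.restrict_map (by fun_prop) measurableSet_Ioc, Real.map_volume_mul_left hpi,
    Measure.restrict_smul, abs_of_nonneg (by positivity), intervalMeasure,
    Measure.restrict_congr_set Ioo_ae_eq_Ioc]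

/-- The representative in `(0, 2π]²` of a point of the torus. -/
def torusLift (y : UnitAddTorus (Fin 2)) : Plane := fun j => circleLift (y j)

theorem measurePreserving_torusLift :
    MeasurePreserving torusLift volume
      (ENNReal.ofReal ((2 * Real.pi)⁻¹ ^ 2) • cellMeasure) := by
  have h : Measure.pi (fun _ : Fin 2 => ENNReal.ofReal (2 * Real.pi)⁻¹ • intervalMeasure) =
      ENNReal.ofReal ((2 * Real.pi)⁻¹ ^ 2) • cellMeasure := by
    refine Measure.pi_eq fun s _ => ?_
    rw [cellMeasure_eq_pi, Measure.smul_apply, Measure.pi_pi, ENNReal.ofReal_pow (by positivity)]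
    simp only [Fin.prod_univ_two, Measure.smul_apply, smul_eq_mul]
    ring
  rw [← h]
  exact measurePreserving_pi _ _ fun _ => measurePreserving_circleLift

theorem mFourier_torusLift (k : Fin 2 → ℤ) (y : UnitAddTorus (Fin 2)) :
    UnitAddTorus.mFourier k y = Complex.exp (phase k (torusLift y) * Complex.I) := by
  have h : ∀ i, fourier (k i) (y i) =
      Complex.exp (((k i : ℝ) * torusLift y i : ℝ) * Complex.I) := by
    intro i
    have h1 : y i = ((AddCircle.equivIoc 1 0 (y i) : ℝ) : UnitAddCircle) :=
      (AddCircle.coe_equivIoc (p := (1 : ℝ)) (a := 0)).symm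
    conv_lhs => rw [h1]
    rw [fourier_coe_apply]
    congr 1
    simp only [torusLift, circleLift]
    push_cast
    ring
  simp only [UnitAddTorus.mFourier, ContinuousMap.coe_mk, h, ← Complex.exp_sum, phase,
    Complex.ofReal_sum, Finset.sum_mul]

/-- A square integrable function on the cell, transported to the torus. -/
def torusFun (f : Plane → ℝ) (y : UnitAddTorus (Fin 2)) : ℂ := (f (torusLift y) : ℂ)

theorem memLp_torusFun {f : Plane → ℝ} (hf : MemLp f 2 cellMeasure) :
    MemLp (torusFun f) 2 volume :=
  ((hf.smul_measure ENNReal.ofReal_ne_top).comp_measurePreserving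
    measurePreserving_torusLift).ofReal

theorem integral_comp_torusLift {E : Type*} [NormedAddCommGroup E] [NormedSpace ℝ E] {G : Plane → E}
    (hG : AEStronglyMeasurable G cellMeasure) :
    ∫ y, G (torusLift y) = (2 * Real.pi)⁻¹ ^ 2 • ∫ x, G x ∂cellMeasure := by
  have h := measurePreserving_torusLift
  rw [← integral_map h.measurable.aemeasurable, h.map_eq, integral_smul_measure,
    ENNReal.toReal_ofReal (by positivity)]
  rw [h.map_eq]
  exact hG.smul_measure _

theorem integrable_mul_of_continuous_bounded {f : Plane → ℝ} (hf : MemLp f 2 cellMeasure)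
    {φ : Plane → ℝ} (hφ : Continuous φ) {C : ℝ} (hC : ∀ x, |φ x| ≤ C) :
    Integrable (fun x => φ x * f x) cellMeasure :=
  (hf.integrable one_le_two).bdd_mul hφ.aestronglyMeasurable (Eventually.of_forall hC)

theorem mFourierCoeff_torusFun {f : Plane → ℝ} (hf : MemLp f 2 cellMeasure) (k : Fin 2 → ℤ) :
    UnitAddTorus.mFourierCoeff ((memLp_torusFun hf).toLp _) k =
      (((2 * Real.pi)⁻¹ ^ 2 * cosCoeff f k : ℝ) : ℂ) -
        (((2 * Real.pi)⁻¹ ^ 2 * sinCoeff f k : ℝ) : ℂ) * Complex.I := by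
  have hcos := integrable_mul_of_continuous_bounded hf
    (Real.continuous_cos.comp (continuous_phase k)) (fun x => Real.abs_cos_le_one _)
  have hsin := integrable_mul_of_continuous_bounded hf
    (Real.continuous_sin.comp (continuous_phase k)) (fun x => Real.abs_sin_le_one _)
  simp only [Function.comp] at hcos hsin
  have h1 : UnitAddTorus.mFourierCoeff ((memLp_torusFun hf).toLp _) k =
      ∫ y, (fun x => ((Real.cos (phase k x) * f x : ℝ) : ℂ) -
        ((Real.sin (phase k x) * f x : ℝ) : ℂ) * Complex.I) (torusLift y) := by
    refine integral_congr_ae ?_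
    filter_upwards [(memLp_torusFun hf).coeFn_toLp] with y hy
    rw [hy, mFourier_torusLift, torusFun, smul_eq_mul, Complex.exp_mul_I]
    have : phase (-k) (torusLift y) = -phase k (torusLift y) := by
      simp [phase]
    rw [this]
    push_cast
    rw [Complex.cos_neg, Complex.sin_neg]
    ring
  rw [h1, integral_comp_torusLift (G := fun x => ((Real.cos (phase k x) * f x : ℝ) : ℂ) -
        ((Real.sin (phase k x) * f x : ℝ) : ℂ) * Complex.I),
    integral_sub hcos.ofReal (hsin.ofReal.mul_const _), integral_mul_const,
    integral_complex_ofReal, integral_complex_ofReal]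
  · simp only [cosCoeff, sinCoeff, Complex.real_smul]
    push_cast
    ring
  · exact (hcos.ofReal.sub (hsin.ofReal.mul_const Complex.I)).aestronglyMeasurable

/-- Parseval's identity. -/
theorem hasSum_sq_coeff {f : Plane → ℝ} (hf : MemLp f 2 cellMeasure) :
    HasSum (fun k => cosCoeff f k ^ 2 + sinCoeff f k ^ 2)
      ((2 * Real.pi) ^ 2 * ∫ x, f x ^ 2 ∂cellMeasure) := by
  have h := UnitAddTorus.hasSum_sq_mFourierCoeff ((memLp_torusFun hf).toLp _)
  have h1 : ∫ y, ‖((memLp_torusFun hf).toLp _ : UnitAddTorus (Fin 2) → ℂ) y‖ ^ 2 =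
      ∫ y, (fun x => f x ^ 2) (torusLift y) := by
    refine integral_congr_ae ?_
    filter_upwards [(memLp_torusFun hf).coeFn_toLp] with y hy
    rw [hy, torusFun, Complex.norm_real, Real.norm_eq_abs, sq_abs]
  rw [h1, integral_comp_torusLift (G := fun x => f x ^ 2) (hf.aestronglyMeasurable.pow 2)] at h
  have h2 := h.mul_left ((2 * Real.pi) ^ 4)
  have hpi := Real.pi_ne_zero
  convert! h2 using 1
  · funext k
    rw [mFourierCoeff_torusFun hf, ← Complex.normSq_eq_norm_sq, Complex.normSq_apply]
    simp only [Complex.mul_re, Complex.sub_re, Complex.sub_im, Complex.ofReal_re,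
      Complex.ofReal_im, Complex.I_re, Complex.I_im, Complex.mul_im]
    field_simp
    ring
  · rw [smul_eq_mul]
    field_simp

theorem tendsto_eLpNorm_sub_fourierSum {f : Plane → ℝ} (hf : MemLp f 2 cellMeasure) :
    Tendsto (fun s => eLpNorm (f - fourierSum s f) 2 cellMeasure) atTop (𝓝 0) := by
  set FL := (memLp_torusFun hf).toLp with hFL
  have h := UnitAddTorus.hasSum_mFourier_series_L2 FL
  have h0 : Tendsto (fun s : Finset (Fin 2 → ℤ) => ‖FL - ∑ k ∈ s,
      UnitAddTorus.mFourierCoeff FL k • UnitAddTorus.mFourierLp 2 k‖ₑ) atTop (𝓝 0) := by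
    have := (tendsto_const_nhds (x := FL)).sub h
    rw [sub_self] at this
    simpa using this.enorm
  have hle : ∀ s, eLpNorm (f - fourierSum s f) 2
      (ENNReal.ofReal ((2 * Real.pi)⁻¹ ^ 2) • cellMeasure)
      ≤ ‖FL - ∑ k ∈ s, UnitAddTorus.mFourierCoeff FL k • UnitAddTorus.mFourierLp 2 k‖ₑ := by
    intro s
    rw [← eLpNorm_comp_measurePreserving (ν := _) _ measurePreserving_torusLift, Lp.enorm_def]
    · refine eLpNorm_mono_ae ?_
      have hk : ∀ᵐ y : UnitAddTorus (Fin 2), ∀ k,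
          UnitAddTorus.mFourierLp 2 k y = UnitAddTorus.mFourier k y :=
        ae_all_iff.2 fun k => UnitAddTorus.coeFn_mFourierLp 2 k
      have hsm : ∀ᵐ y : UnitAddTorus (Fin 2), ∀ k,
          (UnitAddTorus.mFourierCoeff FL k • UnitAddTorus.mFourierLp 2 k :
            Lp ℂ 2 (volume : Measure (UnitAddTorus (Fin 2)))) y =
          UnitAddTorus.mFourierCoeff FL k • UnitAddTorus.mFourierLp 2 k y :=
        ae_all_iff.2 fun k => Lp.coeFn_smul _ _
      filter_upwards [Lp.coeFn_sub FL (∑ k ∈ s, UnitAddTorus.mFourierCoeff FL k •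
          UnitAddTorus.mFourierLp 2 k), Lp.coeFn_finsetSum s (fun k =>
          UnitAddTorus.mFourierCoeff FL k • UnitAddTorus.mFourierLp 2 k), hk, hsm,
          (memLp_torusFun hf).coeFn_toLp] with y h1 h2 h3 h4 h5
      rw [← hFL] at h5
      have hre : ((f - fourierSum s f) ∘ torusLift) y = ((FL - ∑ k ∈ s,
          UnitAddTorus.mFourierCoeff FL k • UnitAddTorus.mFourierLp 2 k :
            Lp ℂ 2 (volume : Measure (UnitAddTorus (Fin 2)))) y).re := by
        rw [h1, Pi.sub_apply, h2, h5, Finset.sum_apply, Complex.sub_re, Complex.re_sum]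
        simp only [h4, h3, Function.comp, Pi.sub_apply, torusFun, Complex.ofReal_re, fourierSum]
        congr 1
        refine Finset.sum_congr rfl fun k _ => ?_
        rw [hFL, mFourierCoeff_torusFun hf, mFourier_torusLift, smul_eq_mul, Complex.exp_mul_I,
          ← Complex.ofReal_cos, ← Complex.ofReal_sin]
        simp only [Complex.mul_re, Complex.sub_re, Complex.add_re, Complex.add_im, Complex.sub_im,
          Complex.ofReal_re, Complex.ofReal_im, Complex.I_re, Complex.I_im, Complex.mul_im]
        ring
      rw [hre, Real.norm_eq_abs]
      exact Complex.abs_re_le_norm _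
    · exact (hf.aestronglyMeasurable.sub
        (isPeriodicTest_fourierSum s f).smooth.continuous.aestronglyMeasurable).smul_measure _
  have h2 := tendsto_of_tendsto_of_tendsto_of_le_of_le tendsto_const_nhds h0
    (fun s => zero_le) hle
  simp only [eLpNorm_smul_measure_of_ne_top (ENNReal.ofNat_ne_top) _
    (ENNReal.ofReal ((2 * Real.pi)⁻¹ ^ 2)), smul_eq_mul] at h2
  set d := ENNReal.ofReal ((2 * Real.pi)⁻¹ ^ 2) ^ (1 / (2 : ENNReal)).toReal with hd
  have hd0 : d ≠ 0 := by
    simp [hd]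
  have hdt : d ≠ ⊤ := ENNReal.rpow_ne_top_of_nonneg ENNReal.toReal_nonneg ENNReal.ofReal_ne_top
  have h3 := ENNReal.Tendsto.const_mul (a := d⁻¹) h2 (Or.inr (ENNReal.inv_ne_top.2 hd0))
  simpa only [← mul_assoc, ENNReal.inv_mul_cancel hd0 hdt, one_mul, mul_zero] using h3

end Torus

section Holder

variable {ι : Type*} {l : Filter ι}

instance holderTriple_four_four_two : ENNReal.HolderTriple 4 4 2 where
  inv_add_inv_eq_inv := by
    have h4 : (4 : ENNReal) = 2 * 2 := by norm_num
    rw [h4, ENNReal.mul_inv (Or.inl (by norm_num)) (Or.inl (by norm_num)), ← mul_add,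
      ENNReal.inv_two_add_inv_two, mul_one]

theorem eLpNorm_mul_le {p q r : ENNReal} [ENNReal.HolderTriple p q r] {f h : Plane → ℝ}
    (hf : AEStronglyMeasurable f cellMeasure) (hh : AEStronglyMeasurable h cellMeasure) :
    eLpNorm (fun x => f x * h x) r cellMeasure ≤
      eLpNorm f p cellMeasure * eLpNorm h q cellMeasure := by
  have := eLpNorm_smul_le_mul_eLpNorm (p := p) (q := q) (r := r) hh hf
  exact this

theorem integrable_mul_of_memLp {f h : Plane → ℝ} (hf : MemLp f 2 cellMeasure)
    (hh : MemLp h 2 cellMeasure) : Integrable (fun x => f x * h x) cellMeasure :=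
  hf.integrable_mul hh

theorem enorm_integral_mul_le {f h : Plane → ℝ} (hf : AEStronglyMeasurable f cellMeasure)
    (hh : AEStronglyMeasurable h cellMeasure) :
    ‖∫ x, f x * h x ∂cellMeasure‖ₑ ≤ eLpNorm f 2 cellMeasure * eLpNorm h 2 cellMeasure := by
  refine (enorm_integral_le_lintegral_enorm _).trans ?_
  rw [← eLpNorm_one_eq_lintegral_enorm]
  exact eLpNorm_mul_le hf hh

theorem tendsto_integral_mul {F : ι → Plane → ℝ} {f h : Plane → ℝ}
    (hF : ∀ i, MemLp (F i) 2 cellMeasure) (hf : MemLp f 2 cellMeasure)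
    (hh : MemLp h 2 cellMeasure)
    (ht : Tendsto (fun i => eLpNorm (f - F i) 2 cellMeasure) l (𝓝 0)) :
    Tendsto (fun i => ∫ x, F i x * h x ∂cellMeasure) l (𝓝 (∫ x, f x * h x ∂cellMeasure)) := by
  rw [tendsto_iff_edist_tendsto_0]
  have h0 : Tendsto (fun i => eLpNorm (f - F i) 2 cellMeasure * eLpNorm h 2 cellMeasure) l
      (𝓝 0) := by
    simpa using ENNReal.Tendsto.mul_const ht (Or.inr hh.eLpNorm_ne_top)
  refine tendsto_of_tendsto_of_tendsto_of_le_of_le tendsto_const_nhds h0 (fun _ => zero_le) ?_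
  intro i
  dsimp only
  rw [edist_comm, edist_eq_enorm_sub, ← integral_sub (integrable_mul_of_memLp hf hh)
    (integrable_mul_of_memLp (hF i) hh)]
  simpa only [Pi.sub_apply, sub_mul] using
    enorm_integral_mul_le (hf.aestronglyMeasurable.sub (hF i).aestronglyMeasurable)
      hh.aestronglyMeasurable

theorem memLp_of_continuous {φ : Plane → ℝ} (hφ : Continuous φ) (p : ENNReal) :
    MemLp φ p cellMeasure := by
  have hK : IsCompact (Set.pi univ fun _ : Fin 2 => Icc (0 : ℝ) (2 * Real.pi)) :=
    isCompact_univ_pi fun _ => isCompact_Icc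
  obtain ⟨C, hC⟩ := hK.exists_bound_of_continuousOn hφ.continuousOn
  refine MemLp.of_bound hφ.aestronglyMeasurable C ?_
  have hm : MeasurableSet cell := MeasurableSet.univ_pi fun _ => measurableSet_Ioo
  filter_upwards [ae_restrict_mem (μ := volume) hm] with x hx
  exact hC x fun i hi => Ioo_subset_Icc_self (hx i hi)

end Holder

section Ladyzhenskaya

variable {ι : Type*} {l : Filter ι}

theorem eLpNorm_four_pow_le_of_contDiff {φ : Plane → ℝ} (hφ : ContDiff ℝ 1 φ) :
    eLpNorm φ 4 cellMeasure ^ 4 ≤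
      (eLpNorm φ 2 cellMeasure ^ 2 +
        2 * (eLpNorm φ 2 cellMeasure * eLpNorm (classicalPartial 0 φ) 2 cellMeasure)) *
      (eLpNorm φ 2 cellMeasure ^ 2 +
        2 * (eLpNorm φ 2 cellMeasure * eLpNorm (classicalPartial 1 φ) 2 cellMeasure)) := by
  have e4 : eLpNorm φ 4 cellMeasure ^ 4 = ∫⁻ x, ‖φ x‖ₑ ^ 4 ∂cellMeasure := by
    have := eLpNorm_nnreal_pow_eq_lintegral (f := φ) (μ := cellMeasure) (p := 4) (by norm_num)
    simpa only [NNReal.coe_ofNat, ENNReal.coe_ofNat, ENNReal.rpow_ofNat] using this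
  have e2 : eLpNorm φ 2 cellMeasure ^ 2 = ∫⁻ x, ‖φ x‖ₑ ^ 2 ∂cellMeasure := by
    have := eLpNorm_nnreal_pow_eq_lintegral (f := φ) (μ := cellMeasure) (p := 2) (by norm_num)
    simpa only [NNReal.coe_ofNat, ENNReal.coe_ofNat, ENNReal.rpow_ofNat] using this
  have hj : ∀ j, ∫⁻ x, (‖φ x‖ₑ ^ 2 + 2 * (‖φ x‖ₑ * ‖classicalPartial j φ x‖ₑ)) ∂cellMeasure ≤
      eLpNorm φ 2 cellMeasure ^ 2 +
        2 * (eLpNorm φ 2 cellMeasure * eLpNorm (classicalPartial j φ) 2 cellMeasure) := by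
    intro j
    have hm : Measurable fun x => ‖φ x‖ₑ := hφ.continuous.measurable.enorm
    rw [lintegral_add_left (hm.pow_const 2), lintegral_const_mul' _ _ (by norm_num), e2]
    gcongr
    have := eLpNorm_mul_le (p := 2) (q := 2) (r := 1) hφ.continuous.aestronglyMeasurable
      (continuous_classicalPartial hφ j).aestronglyMeasurable
    rw [eLpNorm_one_eq_lintegral_enorm] at this
    simpa [enorm_mul] using this
  rw [e4]
  exact (lintegral_pow_four_le hφ).trans (mul_le_mul' (hj 0) (hj 1))

theorem tendsto_eLpNorm_of_sub {F : ι → Plane → ℝ} {f : Plane → ℝ} {p : ENNReal} (hp : 1 ≤ p)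
    (hF : ∀ i, AEStronglyMeasurable (F i) cellMeasure) (hf : MemLp f p cellMeasure)
    (ht : Tendsto (fun i => eLpNorm (f - F i) p cellMeasure) l (𝓝 0)) :
    Tendsto (fun i => eLpNorm (F i) p cellMeasure) l (𝓝 (eLpNorm f p cellMeasure)) := by
  have hfm := hf.aestronglyMeasurable
  have hadd : Tendsto (fun i => eLpNorm f p cellMeasure + eLpNorm (f - F i) p cellMeasure) l
      (𝓝 (eLpNorm f p cellMeasure)) := by simpa using tendsto_const_nhds.add ht
  have hsub : Tendsto (fun i => eLpNorm f p cellMeasure - eLpNorm (f - F i) p cellMeasure) l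
      (𝓝 (eLpNorm f p cellMeasure)) := by
    simpa using ENNReal.Tendsto.sub tendsto_const_nhds ht (Or.inl hf.eLpNorm_ne_top)
  refine tendsto_of_tendsto_of_tendsto_of_le_of_le hsub hadd (fun i => ?_) (fun i => ?_)
  · rw [tsub_le_iff_right]
    calc eLpNorm f p cellMeasure = eLpNorm (F i + (f - F i)) p cellMeasure := by congr 1; abel
      _ ≤ _ := eLpNorm_add_le (hF i) (hfm.sub (hF i)) hp
  · calc eLpNorm (F i) p cellMeasure = eLpNorm (f - (f - F i)) p cellMeasure := by congr 1; abel
      _ ≤ _ := eLpNorm_sub_le hfm (hfm.sub (hF i)) hp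

/-- Ladyzhenskaya's inequality for limits of smooth functions. -/
theorem eLpNorm_four_pow_le_of_tendsto [NeBot l] [IsCountablyGenerated l] {φ : ι → Plane → ℝ}
    {f : Plane → ℝ} {g : Fin 2 → Plane → ℝ} (hφ : ∀ i, ContDiff ℝ 1 (φ i))
    (hf : MemLp f 2 cellMeasure) (hg : ∀ j, MemLp (g j) 2 cellMeasure)
    (ht : Tendsto (fun i => eLpNorm (f - φ i) 2 cellMeasure) l (𝓝 0))
    (htg : ∀ j, Tendsto (fun i => eLpNorm (g j - classicalPartial j (φ i)) 2 cellMeasure) l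
      (𝓝 0)) :
    eLpNorm f 4 cellMeasure ^ 4 ≤
      (eLpNorm f 2 cellMeasure ^ 2 +
        2 * (eLpNorm f 2 cellMeasure * eLpNorm (g 0) 2 cellMeasure)) *
      (eLpNorm f 2 cellMeasure ^ 2 +
        2 * (eLpNorm f 2 cellMeasure * eLpNorm (g 1) 2 cellMeasure)) := by
  have hm : ∀ i, AEStronglyMeasurable (φ i) cellMeasure := fun i =>
    (hφ i).continuous.aestronglyMeasurable
  have t0 := tendsto_eLpNorm_of_sub one_le_two hm hf ht
  have t1 := fun j => tendsto_eLpNorm_of_sub one_le_two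
    (fun i => (continuous_classicalPartial (hφ i) j).aestronglyMeasurable) (hg j) (htg j)
  have hfin := hf.eLpNorm_ne_top
  have tj : ∀ j, Tendsto (fun i => eLpNorm (φ i) 2 cellMeasure ^ 2 +
        2 * (eLpNorm (φ i) 2 cellMeasure * eLpNorm (classicalPartial j (φ i)) 2 cellMeasure)) l
      (𝓝 (eLpNorm f 2 cellMeasure ^ 2 +
        2 * (eLpNorm f 2 cellMeasure * eLpNorm (g j) 2 cellMeasure))) := fun j =>
    (ENNReal.Tendsto.pow t0).add (ENNReal.Tendsto.const_mul
      (ENNReal.Tendsto.mul t0 (Or.inr (hg j).eLpNorm_ne_top) (t1 j) (Or.inr hfin))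
      (Or.inr (by norm_num)))
  have hj_fin : ∀ j, eLpNorm f 2 cellMeasure ^ 2 +
        2 * (eLpNorm f 2 cellMeasure * eLpNorm (g j) 2 cellMeasure) ≠ ⊤ := fun j => by
    have := (hg j).eLpNorm_ne_top
    finiteness
  have tR := ENNReal.Tendsto.mul (tj 0) (Or.inr (hj_fin 1)) (tj 1) (Or.inr (hj_fin 0))
  refine le_of_forall_gt_imp_ge_of_dense fun x hx => ?_
  have hb : ∀ᶠ i in l, eLpNorm (φ i) 4 cellMeasure ≤ x ^ (4 : ℝ)⁻¹ := by
    filter_upwards [tR.eventually (gt_mem_nhds hx)] with i hi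
    rw [ENNReal.le_rpow_inv_iff (by norm_num)]
    refine le_trans ?_ hi.le
    exact_mod_cast eLpNorm_four_pow_le_of_contDiff (hφ i)
  have hmeas : TendstoInMeasure cellMeasure φ l f := by
    refine tendstoInMeasure_of_tendsto_eLpNorm two_ne_zero hm hf.aestronglyMeasurable ?_
    simpa only [eLpNorm_sub_comm] using ht
  have := eLpNorm_le_of_tendstoInMeasure hb hmeas hm
  rw [ENNReal.le_rpow_inv_iff (by norm_num)] at this
  exact_mod_cast this

end Ladyzhenskaya

/-- `g` is the weak partial derivative `∂_j f` of the periodic scalar function `f`. -/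
def IsScalarWeakPartial (j : Fin 2) (f g : Plane → ℝ) : Prop :=
  ∀ φ : Plane → ℝ, IsPeriodicTest φ →
    ∫ x, classicalPartial j φ x * f x ∂cellMeasure = -∫ x, φ x * g x ∂cellMeasure

theorem IsPeriodicTest.contDiff_one {φ : Plane → ℝ} (h : IsPeriodicTest φ) : ContDiff ℝ 1 φ :=
  h.smooth.of_le (by simp)

namespace IsScalarWeakPartial

variable {j : Fin 2} {f g h k : Plane → ℝ}

theorem cosCoeff_eq (hfg : IsScalarWeakPartial j f g) (k : Fin 2 → ℤ) :
    cosCoeff g k = k j * sinCoeff f k := by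
  have h1 := hfg _ (isPeriodicTest_cos k)
  simp only [classicalPartial_cos, neg_mul, integral_neg, neg_inj, mul_assoc,
    integral_const_mul] at h1
  exact h1.symm

theorem sinCoeff_eq (hfg : IsScalarWeakPartial j f g) (k : Fin 2 → ℤ) :
    sinCoeff g k = -(k j * cosCoeff f k) := by
  have h1 := hfg _ (isPeriodicTest_sin k)
  simp only [classicalPartial_sin, mul_assoc, integral_const_mul] at h1
  rw [sinCoeff, cosCoeff, h1, neg_neg]

theorem classicalPartial_fourierSum_eq (hfg : IsScalarWeakPartial j f g)
    (s : Finset (Fin 2 → ℤ)) : classicalPartial j (fourierSum s f) = fourierSum s g :=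
  funext fun x => classicalPartial_fourierSum hfg.cosCoeff_eq hfg.sinCoeff_eq s x

theorem integral_mul_eq (hfg : IsScalarWeakPartial j f g) (hhk : IsScalarWeakPartial j h k)
    (hf : MemLp f 2 cellMeasure) (hg : MemLp g 2 cellMeasure) (hh : MemLp h 2 cellMeasure)
    (hk : MemLp k 2 cellMeasure) :
    ∫ x, g x * h x ∂cellMeasure = -∫ x, f x * k x ∂cellMeasure := by
  have hm : ∀ (f : Plane → ℝ) s, MemLp (fourierSum s f) 2 cellMeasure := fun f s =>
    memLp_of_continuous (isPeriodicTest_fourierSum s f).smooth.continuous 2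
  have t1 := tendsto_integral_mul (hm g) hg hh (tendsto_eLpNorm_sub_fourierSum hg)
  have t2 := (tendsto_integral_mul (hm f) hf hk (tendsto_eLpNorm_sub_fourierSum hf)).neg
  refine tendsto_nhds_unique t1 (t2.congr fun s => ?_)
  rw [← hfg.classicalPartial_fourierSum_eq s]
  exact (hhk _ (isPeriodicTest_fourierSum s f)).symm

theorem ae_eq (hfg : IsScalarWeakPartial j f g) (hfk : IsScalarWeakPartial j f k)
    (hg : MemLp g 2 cellMeasure) (hk : MemLp k 2 cellMeasure) : g =ᵐ[cellMeasure] k := by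
  have hs : ∀ s, fourierSum s g = fourierSum s k := fun s => by
    rw [← hfg.classicalPartial_fourierSum_eq, hfk.classicalPartial_fourierSum_eq]
  have t1 := (tendsto_eLpNorm_sub_fourierSum hg).add (tendsto_eLpNorm_sub_fourierSum hk)
  rw [add_zero] at t1
  have h0 : eLpNorm (g - k) 2 cellMeasure = 0 := by
    refine le_antisymm (ge_of_tendsto' t1 fun s => ?_) zero_le
    have hm := (isPeriodicTest_fourierSum s k).smooth.continuous.aestronglyMeasurable
      (μ := cellMeasure)
    calc eLpNorm (g - k) 2 cellMeasure
        = eLpNorm ((g - fourierSum s k) - (k - fourierSum s k)) 2 cellMeasure := by congr 1; abel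
      _ ≤ _ := by
        rw [hs s]
        exact eLpNorm_sub_le (hg.aestronglyMeasurable.sub hm) (hk.aestronglyMeasurable.sub hm)
          one_le_two
  rw [eLpNorm_eq_zero_iff (hg.aestronglyMeasurable.sub hk.aestronglyMeasurable) two_ne_zero] at h0
  filter_upwards [h0] with x hx
  simpa [sub_eq_zero] using hx

end IsScalarWeakPartial

section Sobolev

variable {f : Plane → ℝ} {g : Fin 2 → Plane → ℝ}

theorem eLpNorm_four_pow_le (hfg : ∀ j, IsScalarWeakPartial j f (g j))
    (hf : MemLp f 2 cellMeasure) (hg : ∀ j, MemLp (g j) 2 cellMeasure) :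
    eLpNorm f 4 cellMeasure ^ 4 ≤
      (eLpNorm f 2 cellMeasure ^ 2 +
        2 * (eLpNorm f 2 cellMeasure * eLpNorm (g 0) 2 cellMeasure)) *
      (eLpNorm f 2 cellMeasure ^ 2 +
        2 * (eLpNorm f 2 cellMeasure * eLpNorm (g 1) 2 cellMeasure)) := by
  refine eLpNorm_four_pow_le_of_tendsto (l := atTop)
    (fun s => (isPeriodicTest_fourierSum s f).contDiff_one) hf hg
    (tendsto_eLpNorm_sub_fourierSum hf) fun j => ?_
  simp only [(hfg j).classicalPartial_fourierSum_eq]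
  exact tendsto_eLpNorm_sub_fourierSum (hg j)

theorem memLp_four (hfg : ∀ j, IsScalarWeakPartial j f (g j))
    (hf : MemLp f 2 cellMeasure) (hg : ∀ j, MemLp (g j) 2 cellMeasure) : MemLp f 4 cellMeasure := by
  refine ⟨hf.aestronglyMeasurable, ?_⟩
  have h := eLpNorm_four_pow_le hfg hf hg
  have h0 := hf.eLpNorm_ne_top
  have h1 := fun j => (hg j).eLpNorm_ne_top
  have h2 := h1 0
  have h3 := h1 1
  have h4 : eLpNorm f 4 cellMeasure ^ 4 < ⊤ := h.trans_lt (by finiteness)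
  by_contra hcon
  rw [not_lt, top_le_iff] at hcon
  simp [hcon] at h4

theorem classicalPartial_sub {φ ψ : Plane → ℝ} (hφ : ContDiff ℝ 1 φ) (hψ : ContDiff ℝ 1 ψ)
    (j : Fin 2) : classicalPartial j (φ - ψ) = classicalPartial j φ - classicalPartial j ψ := by
  funext x
  simp only [classicalPartial, Pi.sub_apply]
  rw [fderiv_sub (hφ.differentiable one_ne_zero x) (hψ.differentiable one_ne_zero x),
    _root_.sub_apply]

theorem tendsto_eLpNorm_four_sub_fourierSum (hfg : ∀ j, IsScalarWeakPartial j f (g j))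
    (hf : MemLp f 2 cellMeasure) (hg : ∀ j, MemLp (g j) 2 cellMeasure) :
    Tendsto (fun s => eLpNorm (f - fourierSum s f) 4 cellMeasure) atTop (𝓝 0) := by
  have hc : ∀ (f : Plane → ℝ) s, ContDiff ℝ 1 (fourierSum s f) := fun f s =>
    (isPeriodicTest_fourierSum s f).contDiff_one
  have hm : ∀ (f : Plane → ℝ) s, MemLp (fourierSum s f) 2 cellMeasure := fun f s =>
    memLp_of_continuous (hc f s).continuous 2
  have key : ∀ s, eLpNorm (f - fourierSum s f) 4 cellMeasure ^ 4 ≤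
      (eLpNorm (f - fourierSum s f) 2 cellMeasure ^ 2 +
        2 * (eLpNorm (f - fourierSum s f) 2 cellMeasure *
          eLpNorm (g 0 - fourierSum s (g 0)) 2 cellMeasure)) *
      (eLpNorm (f - fourierSum s f) 2 cellMeasure ^ 2 +
        2 * (eLpNorm (f - fourierSum s f) 2 cellMeasure *
          eLpNorm (g 1 - fourierSum s (g 1)) 2 cellMeasure)) := by
    intro s
    refine eLpNorm_four_pow_le_of_tendsto (l := atTop)
      (φ := fun t => fourierSum t f - fourierSum s f)
      (g := fun j => g j - fourierSum s (g j)) (fun t => (hc f t).sub (hc f s)) (hf.sub (hm f s))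
      (fun j => (hg j).sub (hm _ s)) ?_ fun j => ?_
    · simpa only [sub_sub_sub_cancel_right] using tendsto_eLpNorm_sub_fourierSum hf
    · simp only [classicalPartial_sub (hc f _) (hc f s), (hfg j).classicalPartial_fourierSum_eq,
        sub_sub_sub_cancel_right]
      exact tendsto_eLpNorm_sub_fourierSum (hg j)
  have t0 := tendsto_eLpNorm_sub_fourierSum hf
  have t1 := fun j => tendsto_eLpNorm_sub_fourierSum (hg j)
  have tj : ∀ j, Tendsto (fun s => eLpNorm (f - fourierSum s f) 2 cellMeasure ^ 2 +
        2 * (eLpNorm (f - fourierSum s f) 2 cellMeasure *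
          eLpNorm (g j - fourierSum s (g j)) 2 cellMeasure)) atTop (𝓝 0) := fun j => by
    simpa using (ENNReal.Tendsto.pow (n := 2) t0).add (ENNReal.Tendsto.const_mul (a := 2)
      (ENNReal.Tendsto.mul t0 (Or.inr ENNReal.zero_ne_top) (t1 j) (Or.inr ENNReal.zero_ne_top))
      (Or.inr (by norm_num)))
  have tR := ENNReal.Tendsto.mul (tj 0) (Or.inr ENNReal.zero_ne_top) (tj 1)
    (Or.inr ENNReal.zero_ne_top)
  have t4 := tendsto_of_tendsto_of_tendsto_of_le_of_le tendsto_const_nhds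
    (by simpa using tR) (fun s => zero_le) key
  have := (ENNReal.continuous_rpow_const (y := (4 : ℝ)⁻¹)).tendsto 0 |>.comp t4
  rw [ENNReal.zero_rpow_of_pos (by norm_num)] at this
  refine this.congr fun s => ?_
  simp only [Function.comp]
  rw [← ENNReal.rpow_natCast, ← ENNReal.rpow_mul]
  norm_num

/-- The transport term is antisymmetric: `∫ (u · ∇f) f = 0` for divergence-free `u ∈ L⁴`. -/
theorem sum_integral_transport_eq_zero (hfg : ∀ j, IsScalarWeakPartial j f (g j))
    (hf : MemLp f 2 cellMeasure) (hg : ∀ j, MemLp (g j) 2 cellMeasure) {u : Fin 2 → Plane → ℝ}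
    (hu : ∀ j, MemLp (u j) 4 cellMeasure)
    (hdiv : ∀ φ, IsPeriodicTest φ → ∑ j, ∫ x, u j x * classicalPartial j φ x ∂cellMeasure = 0) :
    ∑ j, ∫ x, u j x * f x * g j x ∂cellMeasure = 0 := by
  have hc : ∀ (f : Plane → ℝ) s, ContDiff ℝ 1 (fourierSum s f) := fun f s =>
    (isPeriodicTest_fourierSum s f).contDiff_one
  have hm : ∀ (f : Plane → ℝ) s p, MemLp (fourierSum s f) p cellMeasure := fun f s =>
    memLp_of_continuous (hc f s).continuous
  have hf4 := memLp_four hfg hf hg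
  have t4 := tendsto_eLpNorm_four_sub_fourierSum hfg hf hg
  have hlim : ∀ j, Tendsto (fun s => ∫ x, (u j x * fourierSum s f x) * fourierSum s (g j) x
      ∂cellMeasure) atTop (𝓝 (∫ x, u j x * f x * g j x ∂cellMeasure)) := by
    intro j
    rw [tendsto_iff_edist_tendsto_0]
    have tb : Tendsto (fun s =>
        eLpNorm (u j) 4 cellMeasure * eLpNorm (fourierSum s f) 4 cellMeasure *
          eLpNorm (g j - fourierSum s (g j)) 2 cellMeasure +
        eLpNorm (u j) 4 cellMeasure * eLpNorm (f - fourierSum s f) 4 cellMeasure *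
          eLpNorm (g j) 2 cellMeasure) atTop (𝓝 0) := by
      have a1 := tendsto_eLpNorm_of_sub (by norm_num) (fun s => (hm f s 4).aestronglyMeasurable)
        hf4 t4
      have a2 := ENNReal.Tendsto.const_mul (a := eLpNorm (u j) 4 cellMeasure) a1
        (Or.inr (hu j).eLpNorm_ne_top)
      have a3 := ENNReal.Tendsto.mul a2 (Or.inr ENNReal.zero_ne_top)
        (tendsto_eLpNorm_sub_fourierSum (hg j))
        (Or.inr (ENNReal.mul_ne_top (hu j).eLpNorm_ne_top hf4.eLpNorm_ne_top))
      have a4 := ENNReal.Tendsto.const_mul (a := eLpNorm (u j) 4 cellMeasure) t4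
        (Or.inr (hu j).eLpNorm_ne_top)
      have a5 := ENNReal.Tendsto.mul_const a4 (b := eLpNorm (g j) 2 cellMeasure)
        (Or.inr (hg j).eLpNorm_ne_top)
      simpa using a3.add a5
    refine tendsto_of_tendsto_of_tendsto_of_le_of_le tendsto_const_nhds tb (fun _ => zero_le) ?_
    intro s
    dsimp only
    have m1 : MemLp (fun x => u j x * fourierSum s f x) 2 cellMeasure :=
      (hm f s 4).mul' (hu j)
    have m2 : MemLp (fun x => u j x * f x) 2 cellMeasure := hf4.mul' (hu j)
    have m3 : MemLp (fun x => u j x * (f - fourierSum s f) x) 2 cellMeasure :=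
      (hf4.sub (hm f s 4)).mul' (hu j)
    have e : (∫ x, u j x * f x * g j x ∂cellMeasure) -
        ∫ x, (u j x * fourierSum s f x) * fourierSum s (g j) x ∂cellMeasure =
        (∫ x, (u j x * fourierSum s f x) * (g j - fourierSum s (g j)) x ∂cellMeasure) +
        ∫ x, (u j x * (f - fourierSum s f) x) * g j x ∂cellMeasure := by
      rw [← integral_sub (integrable_mul_of_memLp m2 (hg j))
          (integrable_mul_of_memLp m1 (hm (g j) s 2)),
        ← integral_add (integrable_mul_of_memLp m1 ((hg j).sub (hm (g j) s 2)))
          (integrable_mul_of_memLp m3 (hg j))]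
      refine integral_congr_ae (Eventually.of_forall fun x => ?_)
      simp only [Pi.sub_apply]; ring
    rw [edist_comm, edist_eq_enorm_sub, e]
    refine (enorm_add_le _ _).trans (add_le_add ?_ ?_)
    · refine (enorm_integral_mul_le m1.aestronglyMeasurable
        ((hg j).sub (hm (g j) s 2)).aestronglyMeasurable).trans ?_
      gcongr
      exact eLpNorm_mul_le (hu j).aestronglyMeasurable (hm f s 4).aestronglyMeasurable
    · refine (enorm_integral_mul_le m3.aestronglyMeasurable (hg j).aestronglyMeasurable).trans ?_
      gcongr
      exact eLpNorm_mul_le (hu j).aestronglyMeasurable (hf4.sub (hm f s 4)).aestronglyMeasurable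
  have hsum := tendsto_finsetSum Finset.univ fun j _ => hlim j
  refine tendsto_nhds_unique hsum (tendsto_const_nhds.congr fun s => ?_)
  have htest := isPeriodicTest_fourierSum s f
  have hsq : IsPeriodicTest fun x => (2 : ℝ)⁻¹ * fourierSum s f x ^ 2 :=
    ⟨contDiff_const.mul (htest.smooth.pow 2), fun x k => by rw [htest.periodic]⟩
  have h := hdiv _ hsq
  rw [← h]
  refine Finset.sum_congr rfl fun j _ => integral_congr_ae (Eventually.of_forall fun x => ?_)
  dsimp only
  rw [← (hfg j).classicalPartial_fourierSum_eq s]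
  have hd := ((((hc f s).differentiable one_ne_zero x).hasFDerivAt.pow 2).const_mul
    (2 : ℝ)⁻¹).fderiv
  simp only [classicalPartial]
  rw [hd]
  simp
  ring

/-- Comparison of the low Fourier modes: the high modes are controlled by the gradient. -/
theorem sq_mul_integral_sq_le (hfg : ∀ j, IsScalarWeakPartial j f (g j))
    (hf : MemLp f 2 cellMeasure) (hg : ∀ j, MemLp (g j) 2 cellMeasure) {p : Plane → ℝ}
    (hp : MemLp p 2 cellMeasure) {N : ℝ}
    (hcos : ∀ k : Fin 2 → ℤ, ∑ j, (k j : ℝ) ^ 2 < N ^ 2 → cosCoeff p k = cosCoeff f k)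
    (hsin : ∀ k : Fin 2 → ℤ, ∑ j, (k j : ℝ) ^ 2 < N ^ 2 → sinCoeff p k = sinCoeff f k) :
    N ^ 2 * ∫ x, f x ^ 2 ∂cellMeasure ≤
      N ^ 2 * (∫ x, p x ^ 2 ∂cellMeasure) + ∑ j, ∫ x, g j x ^ 2 ∂cellMeasure := by
  have h1 := (hasSum_sq_coeff hf).mul_left (N ^ 2)
  have h2 := ((hasSum_sq_coeff hp).mul_left (N ^ 2)).add
    (hasSum_sum (s := Finset.univ) fun j _ => hasSum_sq_coeff (hg j))
  have h3 := hasSum_le (fun k => ?_) h1 h2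
  · rw [← Finset.mul_sum, mul_left_comm, mul_left_comm (N ^ 2), ← mul_add] at h3
    exact le_of_mul_le_mul_left h3 (by positivity)
  · simp only [(hfg _).cosCoeff_eq, (hfg _).sinCoeff_eq]
    have e : ∑ j, (((k j : ℝ) * sinCoeff f k) ^ 2 + (-((k j : ℝ) * cosCoeff f k)) ^ 2) =
        (∑ j, (k j : ℝ) ^ 2) * (cosCoeff f k ^ 2 + sinCoeff f k ^ 2) := by
      rw [Finset.sum_mul]
      exact Finset.sum_congr rfl fun j _ => by ring
    rw [e]
    have hnn : 0 ≤ cosCoeff f k ^ 2 + sinCoeff f k ^ 2 := by positivity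
    by_cases hk : ∑ j, (k j : ℝ) ^ 2 < N ^ 2
    · rw [hcos k hk, hsin k hk]
      exact le_add_of_nonneg_right (mul_nonneg (Finset.sum_nonneg fun j _ => sq_nonneg _) hnn)
    · have := mul_le_mul_of_nonneg_right (le_of_not_gt hk) hnn
      have h5 : 0 ≤ N ^ 2 * (cosCoeff p k ^ 2 + sinCoeff p k ^ 2) := by positivity
      linarith

end Sobolev

section Components

theorem memLp_comp (u : L2) (i : Fin 2) : MemLp (fun x => u x i) 2 cellMeasure :=
  (EuclideanSpace.proj i : Vec →L[ℝ] ℝ).comp_memLp' (Lp.memLp u)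

theorem eLpNorm_comp_le (u : L2) (i : Fin 2) :
    eLpNorm (fun x => u x i) 2 cellMeasure ≤ ENNReal.ofReal ‖u‖ := by
  rw [ofReal_norm, Lp.enorm_def]
  exact eLpNorm_mono fun x => PiLp.norm_apply_le (u x) i

theorem inner_eq_sum_integral (u v : L2) :
    inner ℝ u v = ∑ i, ∫ x, u x i * v x i ∂cellMeasure := by
  rw [L2.inner_def, ← integral_finsetSum _ fun i _ =>
    integrable_mul_of_memLp (memLp_comp u i) (memLp_comp v i)]
  refine integral_congr_ae (Eventually.of_forall fun x => ?_)
  simp only [PiLp.inner_apply, RCLike.inner_apply, conj_trivial]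
  exact Finset.sum_congr rfl fun i _ => mul_comm _ _

theorem norm_sq_eq_sum_integral (u : L2) : ‖u‖ ^ 2 = ∑ i, ∫ x, u x i ^ 2 ∂cellMeasure := by
  rw [← real_inner_self_eq_norm_sq, inner_eq_sum_integral]
  simp only [sq]

theorem integrable_smul {φ : Plane → ℝ} (hφ : Continuous φ) (u : L2) :
    Integrable (fun x => φ x • u x) cellMeasure :=
  ((Lp.memLp u).smul (r := 1) (p := 2) (q := 2) (memLp_of_continuous hφ 2)).integrable le_rfl

theorem memLp_smul_single {φ : Plane → ℝ} (hφ : Continuous φ) (a : Vec) :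
    MemLp (fun x => φ x • a) 2 cellMeasure :=
  (ContinuousLinearMap.smulRight (1 : ℝ →L[ℝ] ℝ) a).comp_memLp' (memLp_of_continuous hφ 2)

theorem inner_eq_integral_of_ae_eq {w u : L2} {φ : Plane → ℝ} {i : Fin 2}
    (hw : ∀ᵐ x ∂cellMeasure, w x = φ x • EuclideanSpace.single i (1 : ℝ)) :
    inner ℝ w u = ∫ x, φ x * u x i ∂cellMeasure := by
  rw [L2.inner_def]
  refine integral_congr_ae ?_
  filter_upwards [hw] with x hx
  rw [hx, inner_smul_left, EuclideanSpace.inner_single_left]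
  simp

end Components

section WeakPartial

variable {j : Fin 2} {u v g h : L2}

theorem IsWeakPartial.scalar (hug : IsWeakPartial j u g) (i : Fin 2) :
    IsScalarWeakPartial j (fun x => u x i) fun x => g x i := by
  intro φ hφ
  have h := congrArg (EuclideanSpace.proj i : Vec →L[ℝ] ℝ) (hug φ hφ)
  rw [map_neg, ← ContinuousLinearMap.integral_comp_comm _
      (integrable_smul (continuous_classicalPartial hφ.contDiff_one j) u),
    ← ContinuousLinearMap.integral_comp_comm _ (integrable_smul hφ.smooth.continuous g)] at h
  simpa using h

theorem IsWeakPartial.unique (hug : IsWeakPartial j u g) (huh : IsWeakPartial j u h) : g = h := by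
  refine Lp.ext ?_
  have hi : ∀ i, ∀ᵐ x ∂cellMeasure, g x i = h x i := fun i =>
    (hug.scalar i).ae_eq (huh.scalar i) (memLp_comp g i) (memLp_comp h i)
  filter_upwards [ae_all_iff.2 hi] with x hx
  ext i
  exact hx i

theorem IsWeakPartial.pd_eq (hug : IsWeakPartial j u g) : pd j u = g := by
  have hex : ∃ g, IsWeakPartial j u g := ⟨g, hug⟩
  rw [pd, dif_pos hex]
  exact hex.choose_spec.unique hug

theorem isWeakPartial_pd (h : ∃ g, IsWeakPartial j u g) : IsWeakPartial j u (pd j u) := by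
  obtain ⟨g, hg⟩ := h
  rwa [hg.pd_eq]

theorem IsWeakPartial.sub (hug : IsWeakPartial j u g) (hvh : IsWeakPartial j v h) :
    IsWeakPartial j (u - v) (g - h) := by
  intro φ hφ
  have e : ∀ (ψ : Plane → ℝ), Continuous ψ → ∀ a b : L2, ∫ x, ψ x • (a - b : L2) x ∂cellMeasure =
      ∫ x, ψ x • a x ∂cellMeasure - ∫ x, ψ x • b x ∂cellMeasure := by
    intro ψ hψ a b
    rw [← integral_sub (integrable_smul hψ a) (integrable_smul hψ b)]
    refine integral_congr_ae ?_
    filter_upwards [Lp.coeFn_sub a b] with x hx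
    rw [hx, Pi.sub_apply, smul_sub]
  rw [e _ (continuous_classicalPartial hφ.contDiff_one j), e _ hφ.smooth.continuous, hug φ hφ,
    hvh φ hφ]
  abel

theorem sub_mem_V (hu : u ∈ V) (hv : v ∈ V) : u - v ∈ V :=
  ⟨H.sub_mem hu.1 hv.1, fun j =>
    ⟨_, (isWeakPartial_pd (hu.2 j)).sub (isWeakPartial_pd (hv.2 j))⟩⟩

theorem pd_sub (hu : u ∈ V) (hv : v ∈ V) (j : Fin 2) : pd j (u - v) = pd j u - pd j v :=
  ((isWeakPartial_pd (hu.2 j)).sub (isWeakPartial_pd (hv.2 j))).pd_eq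

/-- The norm of `V`. -/
def gradNorm (u : L2) : ℝ := Real.sqrt (∑ j, ‖pd j u‖ ^ 2)

theorem gradNorm_nonneg (u : L2) : 0 ≤ gradNorm u := Real.sqrt_nonneg _

theorem gradNorm_sq (u : L2) : gradNorm u ^ 2 = ∑ j, ‖pd j u‖ ^ 2 :=
  Real.sq_sqrt (Finset.sum_nonneg fun _ _ => sq_nonneg _)

theorem norm_pd_le_gradNorm (u : L2) (j : Fin 2) : ‖pd j u‖ ≤ gradNorm u :=
  Real.le_sqrt_of_sq_le
    (Finset.single_le_sum (f := fun j => ‖pd j u‖ ^ 2) (fun _ _ => sq_nonneg _) (Finset.mem_univ j))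

end WeakPartial

section Spectral

variable {u v : L2}

theorem integral_eq_zero_of_mem_H (hu : u ∈ H) (i : Fin 2) : ∫ x, u x i ∂cellMeasure = 0 := by
  have hm := memLp_smul_single (continuous_const (y := (1 : ℝ))) (EuclideanSpace.single i (1 : ℝ))
  have hw : hm.toLp ∈ constantsAndGradients := by
    refine Or.inl ⟨EuclideanSpace.single i 1, ?_⟩
    filter_upwards [hm.coeFn_toLp] with x hx
    rw [hx, one_smul]
  have h0 := Submodule.inner_right_of_mem_orthogonal (Submodule.subset_span hw) hu
  rw [inner_eq_integral_of_ae_eq hm.coeFn_toLp] at h0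
  simpa using h0

theorem sum_integral_mul_classicalPartial_eq_zero (hu : u ∈ H) {φ : Plane → ℝ}
    (hφ : IsPeriodicTest φ) : ∑ j, ∫ x, u x j * classicalPartial j φ x ∂cellMeasure = 0 := by
  have hc := fun j => continuous_classicalPartial hφ.contDiff_one j
  have hm : MemLp (classicalGrad φ) 2 cellMeasure := by
    have := memLp_finsetSum' Finset.univ fun j (_ : j ∈ Finset.univ) =>
      memLp_smul_single (hc j) (EuclideanSpace.single j (1 : ℝ))
    convert! this using 1
    funext x
    ext i
    fin_cases i <;> simp [classicalGrad, Fin.sum_univ_two]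
  have hw : hm.toLp ∈ constantsAndGradients := Or.inr ⟨φ, hφ, hm.coeFn_toLp⟩
  have h0 := Submodule.inner_right_of_mem_orthogonal (Submodule.subset_span hw) hu
  rw [inner_eq_sum_integral] at h0
  rw [← h0]
  refine Finset.sum_congr rfl fun j _ => integral_congr_ae ?_
  filter_upwards [hm.coeFn_toLp] with x hx
  rw [hx, mul_comm]
  rfl

/-- The Poincaré inequality. -/
theorem norm_le_gradNorm (hu : u ∈ V) : ‖u‖ ≤ gradNorm u := by
  refine Real.le_sqrt_of_sq_le ?_
  have h : ∀ i, ∫ x, u x i ^ 2 ∂cellMeasure ≤ ∑ j, ∫ x, pd j u x i ^ 2 ∂cellMeasure := by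
    intro i
    have hz : ∀ k : Fin 2 → ℤ, ∑ j, (k j : ℝ) ^ 2 < 1 ^ 2 → k = 0 := by
      intro k hk
      have h1 : ∑ j, (k j) ^ 2 < 1 := by exact_mod_cast (one_pow (M := ℝ) 2 ▸ hk)
      rw [Fin.sum_univ_two] at h1
      have h0 : k 0 = 0 := pow_eq_zero_iff two_ne_zero |>.1
        (by nlinarith [sq_nonneg (k 0), sq_nonneg (k 1)])
      have h2 : k 1 = 0 := pow_eq_zero_iff two_ne_zero |>.1
        (by nlinarith [sq_nonneg (k 0), sq_nonneg (k 1)])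
      funext j
      fin_cases j
      · exact h0
      · exact h2
    have := sq_mul_integral_sq_le (p := 0) (N := 1)
      (fun j => (isWeakPartial_pd (hu.2 j)).scalar i) (memLp_comp u i)
      (fun j => memLp_comp (pd j u) i) MemLp.zero
      (fun k hk => by
        have := integral_eq_zero_of_mem_H hu.1 i
        rw [hz k hk]; simp [cosCoeff, phase, this])
      (fun k hk => by rw [hz k hk]; simp [sinCoeff, phase])
    simpa using this
  simp only [norm_sq_eq_sum_integral]
  rw [Finset.sum_comm]
  exact Finset.sum_le_sum fun i _ => h i

/-- The high Fourier modes are controlled by the gradient. -/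
theorem sq_mul_norm_sq_le (hu : u ∈ V) {N : ℝ} (hN : 0 ≤ N) :
    N ^ 2 * ‖u‖ ^ 2 ≤ N ^ 2 * ‖P N u‖ ^ 2 + gradNorm u ^ 2 := by
  have hP : ∀ w ∈ lowModes N, inner ℝ w (P N u) = inner ℝ w u := by
    intro w hw
    have hmem : w ∈ (Submodule.span ℝ (lowModes N)).topologicalClosure :=
      Submodule.le_topologicalClosure _ (Submodule.subset_span hw)
    have := Submodule.inner_right_of_mem_orthogonal hmem
      (Submodule.sub_starProjection_mem_orthogonal
        (K := (Submodule.span ℝ (lowModes N)).topologicalClosure) u)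
    rw [inner_sub_right, sub_eq_zero] at this
    exact this.symm
  have hk : ∀ k : Fin 2 → ℤ, ∑ j, (k j : ℝ) ^ 2 < N ^ 2 → Real.sqrt (∑ j, (k j : ℝ) ^ 2) ≤ N :=
    fun k hk => Real.sqrt_le_iff.2 ⟨hN, hk.le⟩
  have h : ∀ i, N ^ 2 * ∫ x, u x i ^ 2 ∂cellMeasure ≤
      N ^ 2 * (∫ x, P N u x i ^ 2 ∂cellMeasure) + ∑ j, ∫ x, pd j u x i ^ 2 ∂cellMeasure := by
    intro i
    refine sq_mul_integral_sq_le
      (fun j => (isWeakPartial_pd (hu.2 j)).scalar i) (memLp_comp u i)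
      (fun j => memLp_comp (pd j u) i) (memLp_comp (P N u) i) (fun k hkN => ?_) (fun k hkN => ?_)
    · have hm := memLp_smul_single (isPeriodicTest_cos k).smooth.continuous
        (EuclideanSpace.single i (1 : ℝ))
      have := hP hm.toLp ⟨k, _, hk k hkN, Or.inl hm.coeFn_toLp⟩
      rwa [inner_eq_integral_of_ae_eq hm.coeFn_toLp,
        inner_eq_integral_of_ae_eq hm.coeFn_toLp] at this
    · have hm := memLp_smul_single (isPeriodicTest_sin k).smooth.continuous
        (EuclideanSpace.single i (1 : ℝ))
      have := hP hm.toLp ⟨k, _, hk k hkN, Or.inr hm.coeFn_toLp⟩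
      rwa [inner_eq_integral_of_ae_eq hm.coeFn_toLp,
        inner_eq_integral_of_ae_eq hm.coeFn_toLp] at this
  rw [gradNorm_sq]
  simp only [norm_sq_eq_sum_integral]
  rw [Finset.sum_comm (s := Finset.univ) (t := Finset.univ)
      (f := fun j i => ∫ x, pd j u x i ^ 2 ∂cellMeasure),
    Finset.mul_sum, Finset.mul_sum, ← Finset.sum_add_distrib]
  exact Finset.sum_le_sum fun i _ => h i

theorem inner_leray (x : L2) {w : L2} (hw : w ∈ H) : inner ℝ (leray x) w = inner ℝ x w := by
  have := Submodule.inner_left_of_mem_orthogonal hw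
    (Submodule.sub_starProjection_mem_orthogonal (K := H) x)
  rw [inner_sub_left, sub_eq_zero] at this
  exact this.symm

theorem inner_stokes (hu : u ∈ DA) (hv : v ∈ V) :
    inner ℝ (stokes u) v = ∑ j, inner ℝ (pd j u) (pd j v) := by
  rw [stokes, inner_neg_left, inner_leray _ hv.1, sum_inner, ← Finset.sum_neg_distrib]
  refine Finset.sum_congr rfl fun j _ => ?_
  rw [inner_eq_sum_integral, inner_eq_sum_integral, ← Finset.sum_neg_distrib]
  refine Finset.sum_congr rfl fun i _ => ?_
  rw [((isWeakPartial_pd (hu.2 j j)).scalar i).integral_mul_eq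
    ((isWeakPartial_pd (hv.2 j)).scalar i) (memLp_comp _ _) (memLp_comp _ _) (memLp_comp _ _)
    (memLp_comp _ _), neg_neg]

theorem inner_stokes_self (hu : u ∈ DA) : inner ℝ (stokes u) u = gradNorm u ^ 2 := by
  rw [inner_stokes hu hu.1, gradNorm_sq]
  exact Finset.sum_congr rfl fun j _ => real_inner_self_eq_norm_sq _

theorem inner_stokes_sub_self {u₁ u₂ : L2} (h₁ : u₁ ∈ DA) (h₂ : u₂ ∈ DA) :
    inner ℝ (stokes u₁ - stokes u₂) (u₁ - u₂) = gradNorm (u₁ - u₂) ^ 2 := by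
  have hw := sub_mem_V h₁.1 h₂.1
  rw [inner_sub_left, inner_stokes h₁ hw, inner_stokes h₂ hw, gradNorm_sq,
    ← Finset.sum_sub_distrib]
  refine Finset.sum_congr rfl fun j _ => ?_
  rw [← inner_sub_left, ← pd_sub h₁.1 h₂.1, real_inner_self_eq_norm_sq]

end Spectral

section Transport

variable {u v w : L2}

theorem memLp_four_comp (hu : ∀ j, ∃ g, IsWeakPartial j u g) (i : Fin 2) :
    MemLp (fun x => u x i) 4 cellMeasure :=
  memLp_four (fun j => (isWeakPartial_pd (hu j)).scalar i) (memLp_comp u i)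
    fun j => memLp_comp (pd j u) i

theorem eLpNorm_four_comp_le (hu : u ∈ V) (i : Fin 2) :
    eLpNorm (fun x => u x i) 4 cellMeasure ≤
      ENNReal.ofReal (Real.sqrt (3 * (‖u‖ * gradNorm u))) := by
  have h := eLpNorm_four_pow_le (fun j => (isWeakPartial_pd (hu.2 j)).scalar i) (memLp_comp u i)
    fun j => memLp_comp (pd j u) i
  have hG := norm_le_gradNorm hu
  have hn := norm_nonneg u
  have hj : ∀ j, eLpNorm (fun x => u x i) 2 cellMeasure ^ 2 +
      2 * (eLpNorm (fun x => u x i) 2 cellMeasure * eLpNorm (fun x => pd j u x i) 2 cellMeasure) ≤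
      ENNReal.ofReal (3 * (‖u‖ * gradNorm u)) := by
    intro j
    have h1 := eLpNorm_comp_le u i
    have h2 := eLpNorm_comp_le (pd j u) i
    calc _ ≤ ENNReal.ofReal ‖u‖ ^ 2 + 2 * (ENNReal.ofReal ‖u‖ * ENNReal.ofReal ‖pd j u‖) := by
          gcongr
      _ = ENNReal.ofReal (‖u‖ ^ 2 + 2 * (‖u‖ * ‖pd j u‖)) := by
          rw [ENNReal.ofReal_add (by positivity) (by positivity), ENNReal.ofReal_mul (by norm_num),
            ENNReal.ofReal_mul hn, ENNReal.ofReal_pow hn]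
          norm_num
      _ ≤ _ := by
          refine ENNReal.ofReal_le_ofReal ?_
          have := mul_le_mul_of_nonneg_left (norm_pd_le_gradNorm u j) hn
          nlinarith
  have h4 := h.trans (mul_le_mul' (hj 0) (hj 1))
  have hr : ENNReal.ofReal (3 * (‖u‖ * gradNorm u)) * ENNReal.ofReal (3 * (‖u‖ * gradNorm u)) =
      ENNReal.ofReal (Real.sqrt (3 * (‖u‖ * gradNorm u))) ^ 4 := by
    have hnn : 0 ≤ 3 * (‖u‖ * gradNorm u) := by have := gradNorm_nonneg u; positivity
    rw [← ENNReal.ofReal_pow (Real.sqrt_nonneg _), ← ENNReal.ofReal_mul hnn]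
    congr 1
    rw [show (4 : ℕ) = 2 * 2 by norm_num, pow_mul, Real.sq_sqrt hnn, sq]
  rw [hr] at h4
  exact (ENNReal.pow_le_pow_left_iff (by norm_num)).1 h4

/-- The trilinear form `b(u, v, w) = ∫ ((u · ∇) v) · w`. -/
def trilinear (u v w : L2) : ℝ := ∑ i, ∑ j, ∫ x, u x j * w x i * pd j v x i ∂cellMeasure

theorem memLp_mul_comp (hu : u ∈ V) (hw : w ∈ V) (i j : Fin 2) :
    MemLp (fun x => u x j * w x i) 2 cellMeasure :=
  (memLp_four_comp hw.2 i).mul' (memLp_four_comp hu.2 j)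

theorem integrable_trilinear (hu : u ∈ V) (hw : w ∈ V) (v : L2) (i j : Fin 2) :
    Integrable (fun x => u x j * w x i * v x i) cellMeasure :=
  integrable_mul_of_memLp (memLp_mul_comp hu hw i j) (memLp_comp v i)

theorem memLp_advection (hu : u ∈ V) (hv : v ∈ DA) : MemLp (advection u v) 2 cellMeasure := by
  have hs : ∀ i, MemLp (fun x => ∑ j, u x j * pd j v x i) 2 cellMeasure := fun i =>
    memLp_finsetSum _ fun j _ =>
      (memLp_four_comp (fun i' => hv.2 i' j) i).mul' (memLp_four_comp hu.2 j)
  have := memLp_finsetSum' Finset.univ fun i (_ : i ∈ Finset.univ) =>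
    (ContinuousLinearMap.smulRight (1 : ℝ →L[ℝ] ℝ)
      (EuclideanSpace.single i (1 : ℝ) : Vec)).comp_memLp' (hs i)
  convert! this using 1
  funext x
  ext i
  fin_cases i <;> simp [advection, Fin.sum_univ_two]

theorem inner_B (hu : u ∈ V) (hv : v ∈ DA) (hw : w ∈ V) :
    inner ℝ (B u v) w = trilinear u v w := by
  have hm := memLp_advection hu hv
  rw [B, dif_pos hm, inner_leray _ hw.1, inner_eq_sum_integral, trilinear]
  refine Finset.sum_congr rfl fun i _ => ?_
  rw [← integral_finsetSum _ fun j _ => integrable_trilinear hu hw (pd j v) i j]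
  refine integral_congr_ae ?_
  filter_upwards [hm.coeFn_toLp] with x hx
  rw [hx]
  simp only [advection, Fin.sum_univ_two, PiLp.add_apply, PiLp.smul_apply, smul_eq_mul]
  ring

theorem trilinear_self_eq_zero (hu : u ∈ V) (hw : w ∈ V) : trilinear u w w = 0 :=
  Finset.sum_eq_zero fun i _ =>
    sum_integral_transport_eq_zero (fun j => (isWeakPartial_pd (hw.2 j)).scalar i) (memLp_comp w i)
      (fun j => memLp_comp (pd j w) i) (memLp_four_comp hu.2)
      fun _ hφ => sum_integral_mul_classicalPartial_eq_zero hu.1 hφ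

theorem trilinear_sub {u₁ u₂ : L2} (h₁ : u₁ ∈ V) (h₂ : u₂ ∈ V) (hw : w ∈ V) :
    trilinear u₁ u₁ w - trilinear u₂ u₂ w =
      trilinear (u₁ - u₂) u₁ w + trilinear u₂ (u₁ - u₂) w := by
  have hd := sub_mem_V h₁ h₂
  simp only [trilinear, ← Finset.sum_sub_distrib, ← Finset.sum_add_distrib]
  refine Finset.sum_congr rfl fun i _ => Finset.sum_congr rfl fun j _ => ?_
  rw [← integral_sub (integrable_trilinear h₁ hw (pd j u₁) i j)
    (integrable_trilinear h₂ hw (pd j u₂) i j),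
    ← integral_add (integrable_trilinear hd hw (pd j u₁) i j)
    (integrable_trilinear h₂ hw (pd j (u₁ - u₂)) i j), pd_sub h₁ h₂]
  refine integral_congr_ae ?_
  filter_upwards [Lp.coeFn_sub u₁ u₂, Lp.coeFn_sub (pd j u₁) (pd j u₂)] with x hx hx'
  rw [hx, hx']
  simp only [Pi.sub_apply, PiLp.sub_apply]
  ring

theorem abs_trilinear_le (hw : w ∈ V) (v : L2) :
    |trilinear w v w| ≤ 12 * (‖w‖ * gradNorm w * gradNorm v) := by
  have hG := gradNorm_nonneg w
  have h : ∀ i j, |∫ x, w x j * w x i * pd j v x i ∂cellMeasure| ≤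
      3 * (‖w‖ * gradNorm w) * gradNorm v := by
    intro i j
    have hm := memLp_mul_comp hw hw i j
    have h1 := enorm_integral_mul_le hm.aestronglyMeasurable
      (memLp_comp (pd j v) i).aestronglyMeasurable
    have h2 : eLpNorm (fun x => w x j * w x i) 2 cellMeasure ≤
        ENNReal.ofReal (3 * (‖w‖ * gradNorm w)) := by
      refine (eLpNorm_mul_le (p := 4) (q := 4) (memLp_comp w j).aestronglyMeasurable
        (memLp_comp w i).aestronglyMeasurable).trans ?_
      refine (mul_le_mul' (eLpNorm_four_comp_le hw j) (eLpNorm_four_comp_le hw i)).trans_eq ?_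
      rw [← ENNReal.ofReal_mul (Real.sqrt_nonneg _), Real.mul_self_sqrt (by positivity)]
    have h3 := (eLpNorm_comp_le (pd j v) i).trans
      (ENNReal.ofReal_le_ofReal (norm_pd_le_gradNorm v j))
    have h4 := h1.trans (mul_le_mul' h2 h3)
    rw [← ENNReal.ofReal_mul (by positivity), Real.enorm_eq_ofReal_abs] at h4
    exact (ENNReal.ofReal_le_ofReal_iff (mul_nonneg (by positivity) (gradNorm_nonneg v))).1 h4
  rw [trilinear]
  refine (Finset.abs_sum_le_sum_abs _ _).trans ?_
  refine (Finset.sum_le_sum fun i _ => (Finset.abs_sum_le_sum_abs _ _).trans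
    (Finset.sum_le_sum fun j _ => h i j)).trans_eq ?_
  simp
  ring

theorem inner_B_self (hu : u ∈ DA) : inner ℝ (B u u) u = 0 := by
  rw [inner_B hu.1 hu hu.1, trilinear_self_eq_zero hu.1 hu.1]

theorem abs_inner_B_sub_le {u₁ u₂ : L2} (h₁ : u₁ ∈ DA) (h₂ : u₂ ∈ DA) :
    |inner ℝ (B u₁ u₁ - B u₂ u₂) (u₁ - u₂)| ≤
      12 * (‖u₁ - u₂‖ * gradNorm (u₁ - u₂) * gradNorm u₁) := by
  have hw := sub_mem_V h₁.1 h₂.1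
  rw [inner_sub_left, inner_B h₁.1 h₁ hw, inner_B h₂.1 h₂ hw, trilinear_sub h₁.1 h₂.1 hw,
    trilinear_self_eq_zero h₂.1 hw, add_zero]
  exact abs_trilinear_le hw u₁

end Transport

theorem le_of_integral_inequality_of_average_on {φ α : ℝ → ℝ} {s₀ ε κ C : ℝ}
    (hφ : ContinuousOn φ (Ici s₀)) (hα : ContinuousOn α (Ici s₀)) (hε : 0 ≤ ε) (hκ : 0 < κ)
    (h : ∀ s t, s₀ ≤ s → s ≤ t → φ t - φ s ≤ ∫ r in s..t, (ε - α r * φ r))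
    (hC : ∀ s t, s₀ ≤ s → s ≤ t → κ * (t - s) - C ≤ ∫ r in s..t, α r) {t : ℝ} (ht : s₀ ≤ t) :
    φ t ≤ Real.exp C * (Real.exp (-(κ * (t - s₀))) * |φ s₀| + ε / κ) := by
  have hm : Continuous fun t : ℝ => max s₀ t := by fun_prop
  have hc : ∀ ψ : ℝ → ℝ, ContinuousOn ψ (Ici s₀) → Continuous fun t => ψ (max s₀ t) :=
    fun ψ hψ => hψ.comp_continuous hm fun x => mem_Ici.2 (le_max_left _ _)
  have hI : ∀ s t, s₀ ≤ s → s ≤ t → ∀ r ∈ uIcc s t, max s₀ r = r := fun s t hs hst r hr => by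
    rw [uIcc_of_le hst] at hr; exact max_eq_right (hs.trans hr.1)
  have key := le_of_integral_inequality_of_average (hc φ hφ) (hc α hα) hε hκ (s₀ := s₀) (C := C)
    (fun s t hs hst => by
      rw [max_eq_right hs, max_eq_right (hs.trans hst)]
      refine (h s t hs hst).trans_eq (intervalIntegral.integral_congr fun r hr => ?_)
      simp only [hI s t hs hst r hr])
    (fun s t hs hst => by
      refine (hC s t hs hst).trans_eq (intervalIntegral.integral_congr fun r hr => ?_)
      simp only [hI s t hs hst r hr]) ht
  rwa [max_eq_right ht, max_self] at key

/-- Integrated form of a differential inequality for the energy `‖u‖²`. -/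
theorem norm_sq_sub_le_integral {u du : ℝ → L2} {u₀ : L2}
    (hdu : ∀ T : ℝ, 0 < T → MemLp du 2 (volume.restrict (Ioc 0 T)))
    (hu : ∀ t, 0 ≤ t → u t = u₀ + ∫ s in (0 : ℝ)..t, du s) {S : ℝ} (hS : 0 ≤ S) {β : ℝ → ℝ}
    (hβ : ContinuousOn β (Ici S))
    (h : ∀ᵐ t, S < t → 2 * inner ℝ (u t) (du t) ≤ β t) {s t : ℝ} (hs : S ≤ s) (hst : s ≤ t) :
    ‖u t‖ ^ 2 - ‖u s‖ ^ 2 ≤ ∫ r in s..t, β r := by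
  rcases hst.eq_or_lt with rfl | hlt
  · simp
  have ht : 0 < t := (hS.trans hs).trans_lt hlt
  have hdu' : IntervalIntegrable du volume 0 t := by
    rw [intervalIntegrable_iff_integrableOn_Ioc_of_le ht.le]
    exact (hdu t ht).integrable one_le_two
  rw [norm_sq_sub_norm_sq_eq_integral (hS.trans hs) hst hdu' hu]
  refine intervalIntegral.integral_mono_ae_restrict hst
    (intervalIntegrable_inner_deriv (hS.trans hs) hst hdu' hu) ?_ ?_
  · refine ContinuousOn.intervalIntegrable (hβ.mono ?_)
    rw [uIcc_of_le hst]
    exact fun x hx => hs.trans hx.1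
  · have hne : ∀ᵐ x : ℝ, x ≠ S := by simp [ae_iff, measure_singleton]
    rw [EventuallyLE, ae_restrict_iff' measurableSet_Icc]
    filter_upwards [h, hne] with x hx hxS hxI
    exact hx (lt_of_le_of_ne (hs.trans hxI.1) hxS.symm)

theorem exists_norm_le_of_isForce {f : ℝ → L2} (hf : IsForce f) :
    ∃ K : ℝ, 0 ≤ K ∧ ∀ᵐ t, 0 < t → ‖f t‖ ≤ K := by
  refine ⟨(eLpNorm f ⊤ (volume.restrict (Ioi (0 : ℝ)))).toReal, ENNReal.toReal_nonneg, ?_⟩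
  refine (ae_restrict_iff' (measurableSet_Ioi (a := (0 : ℝ)))).1 ?_
  have h := ae_le_eLpNormEssSup (f := f) (μ := volume.restrict (Ioi (0 : ℝ)))
  filter_upwards [h] with t ht
  rw [← eLpNorm_exponent_top] at ht
  have := ENNReal.toReal_mono hf.memLp.eLpNorm_ne_top ht
  simpa using this

namespace IsStrongSolution

variable {ν : ℝ} {F : ℝ → L2} {u₀ : L2} {u : ℝ → L2}

theorem continuousOn_gradNorm (hu : IsStrongSolution ν F u₀ u) :
    ContinuousOn (fun t => gradNorm (u t)) (Ici 0) := by
  unfold gradNorm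
  exact (continuousOn_finsetSum _ fun j _ => (hu.continuousOn_pd j).norm.pow 2).sqrt

/-- The energy inequality. -/
theorem norm_sq_sub_le (hν : 0 < ν) (hu : IsStrongSolution ν F u₀ u) {K : ℝ}
    (hF : ∀ᵐ t, 0 < t → ‖F t‖ ≤ K) {s t : ℝ} (hs : 0 ≤ s) (hst : s ≤ t) :
    ‖u t‖ ^ 2 - ‖u s‖ ^ 2 ≤ ∫ r in s..t, (K ^ 2 / ν - ν * gradNorm (u r) ^ 2) := by
  obtain ⟨du, hdu, hint, heq⟩ := hu.equation
  have hDA := hu.mem_DA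
  rw [ae_restrict_iff' measurableSet_Ioi] at hDA heq
  refine norm_sq_sub_le_integral hdu hint le_rfl
    (β := fun r => K ^ 2 / ν - ν * gradNorm (u r) ^ 2)
    (continuousOn_const.sub (continuousOn_const.mul (hu.continuousOn_gradNorm.pow 2))) ?_ hs hst
  filter_upwards [hDA, heq, hF] with r h1 h2 h3 hr
  have hA := h1 hr
  have hd : du r = F r - ν • stokes (u r) - B (u r) (u r) := by rw [← h2 hr]; abel
  rw [hd, inner_sub_right, inner_sub_right, inner_smul_right, real_inner_comm (stokes (u r)),
    inner_stokes_self hA, real_inner_comm (B (u r) (u r)), inner_B_self hA, sub_zero]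
  have hle : inner ℝ (u r) (F r) ≤ gradNorm (u r) * K :=
    (real_inner_le_norm _ _).trans
      (mul_le_mul (norm_le_gradNorm hA.1) (h3 hr) (norm_nonneg _) (gradNorm_nonneg _))
  have hy : 2 * (gradNorm (u r) * K) ≤ K ^ 2 / ν + ν * gradNorm (u r) ^ 2 := by
    have : 0 ≤ (K - ν * gradNorm (u r)) ^ 2 / ν := by positivity
    have e : (K - ν * gradNorm (u r)) ^ 2 / ν =
        K ^ 2 / ν + ν * gradNorm (u r) ^ 2 - 2 * (gradNorm (u r) * K) := by
      field_simp; ring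
    linarith
  linarith

theorem intervalIntegrable_gradNorm_sq (hu : IsStrongSolution ν F u₀ u) {s t : ℝ} (hs : 0 ≤ s)
    (hst : s ≤ t) : IntervalIntegrable (fun r => gradNorm (u r) ^ 2) volume s t := by
  refine ContinuousOn.intervalIntegrable ((hu.continuousOn_gradNorm.pow 2).mono ?_)
  rw [uIcc_of_le hst]
  exact fun x hx => hs.trans hx.1

/-- The absorbing ball in `H`, with a radius independent of the initial data. -/
theorem eventually_norm_sq_le (hν : 0 < ν) (hu : IsStrongSolution ν F u₀ u) {K : ℝ}
    (hF : ∀ᵐ t, 0 < t → ‖F t‖ ≤ K) : ∀ᶠ t in atTop, ‖u t‖ ^ 2 ≤ K ^ 2 / ν ^ 2 + 1 := by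
  have hb : ∀ t, 0 ≤ t → ‖u t‖ ^ 2 ≤
      Real.exp 0 * (Real.exp (-(ν * (t - 0))) * |‖u 0‖ ^ 2| + K ^ 2 / ν / ν) := by
    intro t ht
    refine le_of_integral_inequality_of_average_on (φ := fun t => ‖u t‖ ^ 2) (α := fun _ => ν)
      (hu.continuousOn.norm.pow 2) continuousOn_const (by positivity) hν ?_ ?_ ht
    · intro s t hs hst
      refine (hu.norm_sq_sub_le hν hF hs hst).trans ?_
      have hc : ContinuousOn (fun r => ‖u r‖ ^ 2) (uIcc s t) := by
        refine (hu.continuousOn.norm.pow 2).mono ?_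
        rw [uIcc_of_le hst]
        exact fun x hx => hs.trans hx.1
      refine intervalIntegral.integral_mono_on hst
        (intervalIntegrable_const.sub ((hu.intervalIntegrable_gradNorm_sq hs hst).const_mul ν))
        (intervalIntegrable_const.sub (hc.intervalIntegrable.const_mul ν)) fun r hr => ?_
      have := norm_le_gradNorm (hu.mem_V r (hs.trans hr.1))
      gcongr
    · intro s t _ _
      simp [mul_comm]
  have hlim : Tendsto (fun t => Real.exp 0 * (Real.exp (-(ν * (t - 0))) * |‖u 0‖ ^ 2| +
      K ^ 2 / ν / ν)) atTop (𝓝 (Real.exp 0 * (0 * |‖u 0‖ ^ 2| + K ^ 2 / ν / ν))) := by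
    refine Tendsto.const_mul _ (Tendsto.add_const _ (Tendsto.mul_const _ ?_))
    refine Real.tendsto_exp_neg_atTop_nhds_zero.comp ?_
    simpa using tendsto_id.const_mul_atTop hν
  have hlt : Real.exp 0 * (0 * |‖u 0‖ ^ 2| + K ^ 2 / ν / ν) < K ^ 2 / ν ^ 2 + 1 := by
    rw [Real.exp_zero, div_div, sq ν]; linarith
  filter_upwards [hlim.eventually (gt_mem_nhds hlt), eventually_ge_atTop 0] with t h1 h2
  exact (hb t h2).trans h1.le

/-- The enstrophy is bounded on average, uniformly in the initial data. -/
theorem eventually_integral_gradNorm_sq_le (hν : 0 < ν) (hu : IsStrongSolution ν F u₀ u) {K : ℝ}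
    (hF : ∀ᵐ t, 0 < t → ‖F t‖ ≤ K) : ∃ S, 0 ≤ S ∧ ∀ s t, S ≤ s → s ≤ t →
      ν * ∫ r in s..t, gradNorm (u r) ^ 2 ≤ K ^ 2 / ν ^ 2 + 1 + K ^ 2 / ν * (t - s) := by
  obtain ⟨S, hS⟩ := eventually_atTop.1 (hu.eventually_norm_sq_le hν hF)
  refine ⟨max S 0, le_max_right _ _, fun s t hs hst => ?_⟩
  have hs0 : 0 ≤ s := (le_max_right _ _).trans hs
  have h1 := hu.norm_sq_sub_le hν hF hs0 hst
  rw [intervalIntegral.integral_sub intervalIntegrable_const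
    ((hu.intervalIntegrable_gradNorm_sq hs0 hst).const_mul ν),
    intervalIntegral.integral_const_mul, intervalIntegral.integral_const, smul_eq_mul] at h1
  have h2 := hS s ((le_max_left _ _).trans hs)
  have h3 := sq_nonneg ‖u t‖
  linarith

variable {F₁ F₂ : ℝ → L2} {u₀₁ u₀₂ : L2} {u₁ u₂ : ℝ → L2}

/-- The energy inequality for the difference of two solutions. -/
theorem norm_sub_sq_sub_le (hν : 0 < ν) (h₁ : IsStrongSolution ν F₁ u₀₁ u₁)
    (h₂ : IsStrongSolution ν F₂ u₀₂ u₂) {N : ℝ} (hN : 0 ≤ N) {S η : ℝ} (hS : 0 ≤ S)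
    (hη : ∀ᵐ t, S < t → 2 * (‖u₁ t - u₂ t‖ * ‖F₁ t - F₂ t‖) +
      ν * (N ^ 2 * ‖P N (u₁ t - u₂ t)‖ ^ 2) ≤ η) {s t : ℝ} (hs : S ≤ s) (hst : s ≤ t) :
    ‖u₁ t - u₂ t‖ ^ 2 - ‖u₁ s - u₂ s‖ ^ 2 ≤
      ∫ r in s..t, (η - (ν * N ^ 2 - 144 / ν * gradNorm (u₁ r) ^ 2) * ‖u₁ r - u₂ r‖ ^ 2) := by
  obtain ⟨du₁, hdu₁, hint₁, heq₁⟩ := h₁.equation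
  obtain ⟨du₂, hdu₂, hint₂, heq₂⟩ := h₂.equation
  have hDA₁ := h₁.mem_DA
  have hDA₂ := h₂.mem_DA
  rw [ae_restrict_iff' measurableSet_Ioi] at hDA₁ heq₁ hDA₂ heq₂
  have hsubset : Ici S ⊆ Ici (0 : ℝ) := Ici_subset_Ici.2 hS
  refine norm_sq_sub_le_integral (u := fun t => u₁ t - u₂ t) (du := fun t => du₁ t - du₂ t)
    (u₀ := u₀₁ - u₀₂) (fun T hT => (hdu₁ T hT).sub (hdu₂ T hT)) ?_ hS
    (β := fun r => η - (ν * N ^ 2 - 144 / ν * gradNorm (u₁ r) ^ 2) * ‖u₁ r - u₂ r‖ ^ 2) ?_ ?_ hs hst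
  · intro t ht
    have hii : ∀ du : ℝ → L2, (∀ T : ℝ, 0 < T → MemLp du 2 (volume.restrict (Ioc 0 T))) →
        IntervalIntegrable du volume 0 t := by
      intro du hdu
      rcases ht.eq_or_lt with rfl | ht'
      · simp
      · rw [intervalIntegrable_iff_integrableOn_Ioc_of_le ht]
        exact (hdu t ht').integrable one_le_two
    rw [hint₁ t ht, hint₂ t ht, intervalIntegral.integral_sub (hii _ hdu₁) (hii _ hdu₂)]
    abel
  · have c1 := (h₁.continuousOn_gradNorm.mono hsubset).pow 2
    have c2 := ((h₁.continuousOn.mono hsubset).sub (h₂.continuousOn.mono hsubset)).norm.pow 2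
    exact continuousOn_const.sub ((continuousOn_const.sub (continuousOn_const.mul c1)).mul c2)
  · filter_upwards [hDA₁, heq₁, hDA₂, heq₂, hη] with r a1 e1 a2 e2 h3 hrS
    have hr : r ∈ Ioi (0 : ℝ) := hS.trans_lt hrS
    have hA₁ := a1 hr
    have hA₂ := a2 hr
    set w := u₁ r - u₂ r with hw
    set G := gradNorm w with hG
    set G₁ := gradNorm (u₁ r) with hG₁
    have hd : du₁ r - du₂ r = (F₁ r - F₂ r) - ν • (stokes (u₁ r) - stokes (u₂ r)) -
        (B (u₁ r) (u₁ r) - B (u₂ r) (u₂ r)) := by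
      rw [← e1 hr, ← e2 hr, smul_sub]; abel
    have hst := inner_stokes_sub_self hA₁ hA₂
    have hB := abs_inner_B_sub_le hA₁ hA₂
    have hP := sq_mul_norm_sq_le (sub_mem_V hA₁.1 hA₂.1) hN
    rw [← hw, ← hG] at hst hB hP
    rw [← hG₁] at hB
    rw [hd, inner_sub_right, inner_sub_right, inner_smul_right, real_inner_comm (stokes _ - _),
      hst, real_inner_comm (B _ _ - _)]
    have hf := real_inner_le_norm w (F₁ r - F₂ r)
    have hB' := (abs_le.1 hB).1
    have h4 := h3 hrS
    have hP' := mul_le_mul_of_nonneg_left hP hν.le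
    have hy : 24 * (‖w‖ * G * G₁) ≤ ν * G ^ 2 + 144 / ν * G₁ ^ 2 * ‖w‖ ^ 2 := by
      have : 0 ≤ (ν * G - 12 * (‖w‖ * G₁)) ^ 2 / ν := by positivity
      have e : (ν * G - 12 * (‖w‖ * G₁)) ^ 2 / ν =
          ν * G ^ 2 + 144 / ν * G₁ ^ 2 * ‖w‖ ^ 2 - 24 * (‖w‖ * G * G₁) := by
        field_simp; ring
      linarith
    linarith

end IsStrongSolution

theorem exists_ae_norm_sub_le_of_forcesConverge {f g : ℝ → L2} (h : ForcesConverge f g) {ε : ℝ}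
    (hε : 0 < ε) : ∃ S : ℝ, ∀ᵐ t, S < t → ‖f t - g t‖ ≤ ε := by
  have h1 : ∀ᶠ t in atTop ⊓ ae (volume : Measure ℝ), ‖f t - g t‖ < ε :=
    Tendsto.eventually h (gt_mem_nhds hε)
  obtain ⟨A, hA, C, hC, hAC⟩ := mem_inf_iff_superset.1 h1
  obtain ⟨S, hS⟩ := mem_atTop_sets.1 hA
  refine ⟨S, ?_⟩
  filter_upwards [hC] with t ht hSt
  exact le_of_lt (hAC ⟨hS t (le_of_lt hSt), ht⟩)

/-- The Navier-Stokes equations have finitely many determining modes (Foias and Prodi). The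
cut-off depends on the viscosity and on the bounds for the forces only. -/
theorem hasFiniteDeterminingModes {ν : ℝ} (hν : 0 < ν) {f₁ f₂ : ℝ → L2} (hf₁ : IsForce f₁)
    (hf₂ : IsForce f₂) : HasFiniteDeterminingModes ν f₁ f₂ := by
  obtain ⟨K₁, hK₁, hF₁⟩ := exists_norm_le_of_isForce hf₁
  obtain ⟨K₂, hK₂, hF₂⟩ := exists_norm_le_of_isForce hf₂
  set Q := (144 / ν ^ 2 * (K₁ ^ 2 / ν) + 1) / ν with hQ
  have hQpos : 0 < Q := by positivity
  refine ⟨Real.sqrt Q, Real.sqrt_pos.2 hQpos, ?_⟩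
  intro u₀₁ _ u₀₂ _ u₁ u₂ h₁ h₂ hP hforce
  set N := Real.sqrt Q with hN
  have hN2 : N ^ 2 = Q := Real.sq_sqrt hQpos.le
  obtain ⟨S₁, hS₁, hE⟩ := h₁.eventually_integral_gradNorm_sq_le hν hF₁
  set C := 144 / ν ^ 2 * (K₁ ^ 2 / ν ^ 2 + 1) with hC
  set R := (K₁ ^ 2 / ν ^ 2 + 1) + (K₂ ^ 2 / ν ^ 2 + 1) with hR
  have hRpos : 0 < R := by positivity
  have hbound : ∀ᶠ t in atTop, ‖u₁ t - u₂ t‖ ≤ R := by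
    filter_upwards [h₁.eventually_norm_sq_le hν hF₁, h₂.eventually_norm_sq_le hν hF₂] with t a b
    have e : ∀ K x : ℝ, x ^ 2 ≤ K ^ 2 / ν ^ 2 + 1 → x ≤ K ^ 2 / ν ^ 2 + 1 := by
      intro K x hx
      have : 0 ≤ K ^ 2 / ν ^ 2 := by positivity
      nlinarith
    exact (norm_sub_le _ _).trans (add_le_add (e _ _ a) (e _ _ b))
  have hα : ∀ s t, S₁ ≤ s → s ≤ t →
      1 * (t - s) - C ≤ ∫ r in s..t, (ν * N ^ 2 - 144 / ν * gradNorm (u₁ r) ^ 2) := by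
    intro s t hs hst
    have hs0 := hS₁.trans hs
    rw [intervalIntegral.integral_sub intervalIntegrable_const
      ((h₁.intervalIntegrable_gradNorm_sq hs0 hst).const_mul _),
      intervalIntegral.integral_const, intervalIntegral.integral_const_mul, smul_eq_mul, hN2]
    have h5 := mul_le_mul_of_nonneg_left (hE s t hs hst)
      (show 0 ≤ 144 / ν ^ 2 by positivity)
    have e1 : 144 / ν ^ 2 * (ν * ∫ r in s..t, gradNorm (u₁ r) ^ 2) =
        144 / ν * ∫ r in s..t, gradNorm (u₁ r) ^ 2 := by field_simp
    have e2 : ν * Q = 144 / ν ^ 2 * (K₁ ^ 2 / ν) + 1 := by rw [hQ]; field_simp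
    rw [e1] at h5
    rw [e2, hC]
    linarith
  have hmain : Tendsto (fun t => ‖u₁ t - u₂ t‖ ^ 2) atTop (𝓝 0) := by
    rw [Metric.tendsto_atTop']
    intro δ hδ
    set η := δ / (2 * Real.exp C) with hη
    have hηpos : 0 < η := by positivity
    obtain ⟨S₂, hS₂⟩ := exists_ae_norm_sub_le_of_forcesConverge hforce
      (show 0 < η / (4 * R) by positivity)
    have hPN : Tendsto (fun t => ν * (N ^ 2 * ‖P N (u₁ t - u₂ t)‖ ^ 2)) atTop (𝓝 0) := by
      have := ((hP.pow 2).const_mul (N ^ 2)).const_mul ν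
      simpa using this
    obtain ⟨S₃, hS₃⟩ := eventually_atTop.1 (hPN.eventually (gt_mem_nhds (half_pos hηpos)))
    obtain ⟨S₄, hS₄⟩ := eventually_atTop.1 hbound
    set S := max (max S₁ S₂) (max S₃ S₄) with hS
    have hSS₁ : S₁ ≤ S := (le_max_left _ _).trans (le_max_left _ _)
    have hSS₂ : S₂ ≤ S := (le_max_right _ _).trans (le_max_left _ _)
    have hSS₃ : S₃ ≤ S := (le_max_left _ _).trans (le_max_right _ _)
    have hSS₄ : S₄ ≤ S := (le_max_right _ _).trans (le_max_right _ _)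
    have hS0 : 0 ≤ S := hS₁.trans hSS₁
    have hsmall : ∀ᵐ t, S < t → 2 * (‖u₁ t - u₂ t‖ * ‖f₁ t - f₂ t‖) +
        ν * (N ^ 2 * ‖P N (u₁ t - u₂ t)‖ ^ 2) ≤ η := by
      filter_upwards [hS₂] with t ht hSt
      have b1 := hS₄ t (hSS₄.trans hSt.le)
      have b2 := ht (hSS₂.trans_lt hSt)
      have b3 := hS₃ t (hSS₃.trans hSt.le)
      have b4 := mul_le_mul b1 b2 (norm_nonneg _) hRpos.le
      have b5 : R * (η / (4 * R)) = η / 4 := by field_simp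
      rw [b5] at b4
      linarith
    have hsubset : Ici S ⊆ Ici (0 : ℝ) := Ici_subset_Ici.2 hS0
    have hgron : ∀ t, S ≤ t → ‖u₁ t - u₂ t‖ ^ 2 ≤
        Real.exp C * (Real.exp (-(1 * (t - S))) * |‖u₁ S - u₂ S‖ ^ 2| + η / 1) := by
      intro t ht
      refine le_of_integral_inequality_of_average_on (φ := fun t => ‖u₁ t - u₂ t‖ ^ 2)
        (α := fun r => ν * N ^ 2 - 144 / ν * gradNorm (u₁ r) ^ 2)
        (((h₁.continuousOn.mono hsubset).sub (h₂.continuousOn.mono hsubset)).norm.pow 2)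
        (continuousOn_const.sub
          (continuousOn_const.mul ((h₁.continuousOn_gradNorm.mono hsubset).pow 2)))
        hηpos.le one_pos (fun s t hs hst => ?_) (fun s t hs hst => hα s t (hSS₁.trans hs) hst) ht
      exact h₁.norm_sub_sq_sub_le hν h₂ (Real.sqrt_nonneg _) hS0 hsmall hs hst
    have hlim : Tendsto (fun t => Real.exp C *
        (Real.exp (-(1 * (t - S))) * |‖u₁ S - u₂ S‖ ^ 2| + η / 1)) atTop
        (𝓝 (Real.exp C * (0 * |‖u₁ S - u₂ S‖ ^ 2| + η / 1))) := by
      refine Tendsto.const_mul _ (Tendsto.add_const _ (Tendsto.mul_const _ ?_))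
      refine Real.tendsto_exp_neg_atTop_nhds_zero.comp ?_
      simpa [sub_eq_add_neg] using tendsto_atTop_add_const_right atTop (-S) tendsto_id
    have hlt : Real.exp C * (0 * |‖u₁ S - u₂ S‖ ^ 2| + η / 1) < δ := by
      have : Real.exp C * η = δ / 2 := by rw [hη]; field_simp
      rw [zero_mul, zero_add, div_one, this]; linarith
    obtain ⟨T, hT⟩ := eventually_atTop.1 (hlim.eventually (gt_mem_nhds hlt))
    refine ⟨max S T, fun t ht => ?_⟩
    rw [Real.dist_eq, sub_zero, abs_of_nonneg (sq_nonneg _)]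
    exact (hgron t ((le_max_left _ _).trans ht.le)).trans_lt (hT t ((le_max_right _ _).trans ht.le))
  simpa using hmain.sqrt

theorem isFinDimAssistedSelfSynchronous_trivial {ν : ℝ} {f₁ f₂ : ℝ → L2}
    (h : HasFiniteDeterminingModes ν f₁ f₂) (M : Matrix (Fin 2) (Fin 2) ℝ) :
    (Intertwinement.trivial M).IsFinDimAssistedSelfSynchronous ν f₁ f₂ := by
  obtain ⟨N, hN, hdet⟩ := h
  refine ⟨N, hN, fun v₀₁ h₁ v₀₂ h₂ v₁ v₂ hsol => hdet v₀₁ h₁ v₀₂ h₂ v₁ v₂ ?_ ?_⟩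
  · simpa [Intertwinement.trivial] using hsol.1
  · simpa [Intertwinement.trivial] using hsol.2

end NavierStokes2D

end

theorem mainTheorem3 (ν : ℝ) (hν : 0 < ν) (f₁ f₂ : ℝ → NavierStokes2D.L2)
    (hf₁ : NavierStokes2D.IsForce f₁) (hf₂ : NavierStokes2D.IsForce f₂)
    (hsync₁ : NavierStokes2D.HasSynchronizationProperty ν f₁)
    (hsync₂ : NavierStokes2D.HasSynchronizationProperty ν f₂) :
    NavierStokes2D.HasFiniteDeterminingModes ν f₁ f₂ ∧
      ∀ M : Matrix (Fin 2) (Fin 2) ℝ,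
        (NavierStokes2D.Intertwinement.trivial M).IsFinDimAssistedSelfSynchronous ν f₁ f₂ := by
  have h := NavierStokes2D.hasFiniteDeterminingModes hν hf₁ hf₂
  exact ⟨h, NavierStokes2D.isFinDimAssistedSelfSynchronous_trivial h⟩
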